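/- Let $\ell\ge 3$ be an odd integer and $\xi=\exp(2\pi i/\ell)$. Let $\mathcal U^\sigma$ be the $\mathbb C$-algebra generated by $k_1^{\pm1},k_2^{\pm1},e_1,e_2,f_1,f_2,\sigma$ with relations $$k_1k_2=k_2k_1,\quad k_ik_i^{-1}=k_i^{-1}k_i=1,\quad k_ie_jk_i^{-1}=\xi^{a_{ij}}e_j,\quad k_if_jk_i^{-1}=\xi^{-a_{ij}}f_j,$$ $$e_1f_1-f_1e_1=\frac{k_1-k_1^{-1}}{\xi-\xi^{-1}},\quad e_2f_2+f_2e_2=\frac{k_2-k_2^{-1}}{\xi-\xi^{-1}},\quad e_1f_2=f_2e_1,\quad e_2f_1=f_1e_2,$$ $$e_2^2=f_2^2=0,\quad e_1^2e_2-(\xi+\xi^{-1})e_1e_2e_1+e_2e_1^2=0,\quad f_1^2f_2-(\xi+\xi^{-1})f_1f_2f_1+f_2f_1^2=0,\quad e_1^\ell=f_1^\ell=0,$$ $$\sigma^2=1,\quad \sigma k_i=k_i\sigma,\quad \sigma e_i=(-1)^{p_i}e_i\sigma,\quad \sigma f_i=(-1)^{p_i}f_i\sigma,$$ where $a_{11}=2$,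 $a_{12}=a_{21}=-1$, $a_{22}=0$ and $p_1=0$, $p_2=1$. It is a Hopf algebra (the bosonization of the quotient of the quantum superalgebra $\mathcal U_\xi\mathfrak{sl}(2|1)$ by $e_1^\ell,f_1^\ell$) with $$\Delta(k_i)=k_i\otimes k_i,\quad \Delta(\sigma)=\sigma\otimes\sigma,\quad \Delta(e_i)=e_i\otimes1+k_i^{-1}\sigma^{p_i}\otimes e_i,\quad \Delta(f_i)=f_i\otimes k_i+\sigma^{p_i}\otimes f_i,$$ $$\varepsilon(k_i)=\varepsilon(\sigma)=1,\quad \varepsilon(e_i)=\varepsilon(f_i)=0,$$ $$S(k_i)=k_i^{-1},\quad S(\sigma)=\sigma,\quad S(e_i)=-\sigma^{p_i}k_ie_i,\quad S(f_i)=-\sigma^{p_i}f_ik_i^{-1}.$$ Let $\mathcal U_{\overline 0}$ be the small (restricted) quantum group, that is, the quotient Hopf algebra of $\mathcal U^\sigma$ by the ideal generated by the central elements $k_1^\ell-1$ and $k_2^\ell-1$. Then $\mathcal U_{\overline 0}$ is unimodular: it is finite-dimensional, it has a nonzero left integral, and its space of left integrals $\{t : xt=\varepsilon(x)t \text{ for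 all } x\}$ equals its space of right integrals $\{t : tx=\varepsilon(x)t\text{ for all } x\}$. -/

import Mathlib

namespace SmallQuantumSl21

/-! ## The `q`-binomial theorem and the Serre relation in general algebras -/

section Algebra
variable {A : Type*} [Ring A] [Algebra ℂ A]

def gaussCoeff (q : ℂ) : ℕ → ℕ → ℂ
  | 0, _ => 1
  | _ + 1, 0 => 1
  | a + 1, b + 1 => gaussCoeff q a (b + 1) + q ^ (a + 1) * gaussCoeff q (a + 1) b
termination_by a b => a + b

def qNum (q : ℂ) (n : ℕ) : ℂ := ∑ i ∈ Finset.range n, q ^ i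

def qFact (q : ℂ) (n : ℕ) : ℂ := ∏ i ∈ Finset.range n, qNum q (i + 1)

theorem gaussCoeff_zero_right (q : ℂ) (a : ℕ) : gaussCoeff q a 0 = 1 := by
  cases a <;> simp [gaussCoeff]

theorem gaussCoeff_zero_left (q : ℂ) (a : ℕ) : gaussCoeff q 0 a = 1 := by
  simp [gaussCoeff]

theorem gaussCoeff_mul (q : ℂ) (a b : ℕ) :
    gaussCoeff q a b * (qFact q a * qFact q b) = qFact q (a + b) := by
  induction a, b using gaussCoeff.induct with
  | case1 b => simp [gaussCoeff, qFact]
  | case2 a => simp [gaussCoeff, qFact]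
  | case3 a b h1 h2 =>
    have e1 : ∀ n, qFact q (n + 1) = qFact q n * qNum q (n + 1) := fun n => by
      simp [qFact, Finset.prod_range_succ]
    have e2 : qNum q (a + 1 + (b + 1)) = qNum q (a + 1) + q ^ (a + 1) * qNum q (b + 1) := by
      simp only [qNum]
      rw [Finset.sum_range_add, Finset.mul_sum]
      simp [pow_add]
    rw [gaussCoeff, show a + 1 + (b + 1) = (a + 1 + b) + 1 by ring, e1 (a + 1 + b),
      show a + 1 + b + 1 = a + 1 + (b + 1) by ring, e2]
    rw [show a + (b + 1) = a + 1 + b by ring] at h1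
    rw [mul_add, ← h2]
    nth_rw 1 [h2]
    rw [← h1, e1 a, e1 b]
    ring

theorem qNum_ne_zero {q : ℂ} {l : ℕ} (hq : IsPrimitiveRoot q l) {n : ℕ} (h0 : 0 < n)
    (hn : n < l) : qNum q n ≠ 0 := by
  intro h
  have := mul_neg_geom_sum q n
  rw [qNum] at h
  rw [h, mul_zero] at this
  exact hq.pow_ne_one_of_pos_of_lt h0.ne' hn (sub_eq_zero.mp this.symm).symm

theorem gaussCoeff_eq_zero {q : ℂ} {l : ℕ} (hq : IsPrimitiveRoot q l) {a b : ℕ}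
    (hab : a + b = l) (ha : 0 < a) (hb : 0 < b) : gaussCoeff q a b = 0 := by
  have h := gaussCoeff_mul q a b
  have hz : qFact q (a + b) = 0 := by
    rw [hab, qFact, Finset.prod_eq_zero_iff]
    refine ⟨l - 1, by simp; omega, ?_⟩
    rw [show l - 1 + 1 = l by omega, qNum]
    exact hq.geom_sum_eq_zero (by omega)
  have hne : ∀ n < l, qFact q n ≠ 0 := fun n hn => by
    rw [qFact, Finset.prod_ne_zero_iff]
    intro i hi
    exact qNum_ne_zero hq (by omega) (by simp at hi; omega)
  rw [hz] at h
  rcases mul_eq_zero.mp h with h | h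
  · exact h
  · exact absurd h (mul_ne_zero (hne a (by omega)) (hne b (by omega)))

theorem mul_pow_of_qcomm {q : ℂ} {x y : A} (h : y * x = q • (x * y)) (n : ℕ) :
    y * x ^ n = q ^ n • (x ^ n * y) := by
  induction n with
  | zero => simp
  | succ n ih =>
    rw [pow_succ, ← mul_assoc, ih, smul_mul_assoc, mul_assoc, h, mul_smul_comm, smul_smul,
      ← pow_succ, mul_assoc]

theorem pow_mul_of_qcomm {q : ℂ} {x y : A} (h : y * x = q • (x * y)) (n : ℕ) :
    y ^ n * x = q ^ n • (x * y ^ n) := by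
  induction n with
  | zero => simp
  | succ n ih =>
    rw [pow_succ', mul_assoc, ih, mul_smul_comm, ← mul_assoc, h, smul_mul_assoc, smul_smul,
      ← pow_succ, mul_assoc]

theorem add_pow_of_qcomm {q : ℂ} {x y : A} (h : y * x = q • (x * y)) (n : ℕ) :
    (x + y) ^ n = ∑ p ∈ Finset.HasAntidiagonal.antidiagonal n, gaussCoeff q p.1 p.2 • (x ^ p.1 * y ^ p.2) := by
  induction n with
  | zero => simp [gaussCoeff]
  | succ n ih =>
    rw [pow_succ', ih, Finset.mul_sum, Finset.Nat.sum_antidiagonal_succ]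
    have key : ∀ p : ℕ × ℕ, (x + y) * gaussCoeff q p.1 p.2 • (x ^ p.1 * y ^ p.2)
        = gaussCoeff q p.1 p.2 • (x ^ (p.1 + 1) * y ^ p.2)
          + (q ^ p.1 * gaussCoeff q p.1 p.2) • (x ^ p.1 * y ^ (p.2 + 1)) := by
      intro p
      rw [add_mul, mul_smul_comm, mul_smul_comm, ← mul_assoc, ← mul_assoc, mul_pow_of_qcomm h,
        smul_mul_assoc, smul_smul, mul_assoc _ y, ← pow_succ', ← pow_succ', mul_comm (q ^ p.1)]
    simp only [key, Finset.sum_add_distrib]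
    cases n with
    | zero => simp [gaussCoeff, add_comm]
    | succ m =>
      rw [Finset.Nat.sum_antidiagonal_succ (f := fun p : ℕ × ℕ =>
        (q ^ p.1 * gaussCoeff q p.1 p.2) • (x ^ p.1 * y ^ (p.2 + 1)))]
      rw [Finset.Nat.sum_antidiagonal_succ', Finset.Nat.sum_antidiagonal_succ']
      simp only [gaussCoeff, gaussCoeff_zero_right, add_smul, Finset.sum_add_distrib]
      simp
      abel

theorem add_pow_primitive {q : ℂ} {l : ℕ} (hq : IsPrimitiveRoot q l) (hl : 0 < l) {x y : A}
    (h : y * x = q • (x * y)) : (x + y) ^ l = x ^ l + y ^ l := by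
  rw [add_pow_of_qcomm h]
  obtain ⟨m, rfl⟩ : ∃ m, l = m + 1 := ⟨l - 1, by omega⟩
  rw [Finset.Nat.sum_antidiagonal_succ]
  cases m with
  | zero => simp [gaussCoeff, add_comm]
  | succ m =>
    rw [Finset.Nat.sum_antidiagonal_succ', Finset.sum_eq_zero]
    · simp [gaussCoeff, gaussCoeff_zero_right, add_comm]
    · intro p hp
      rw [Finset.HasAntidiagonal.mem_antidiagonal] at hp
      rw [gaussCoeff_eq_zero hq (by omega) (by omega) (by omega), zero_smul]

theorem qcomm_mul_pow {c : ℂ} {g x : A} (h : x * g = c • (g * x)) (n : ℕ) :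
    ∃ d : ℂ, (g * x) ^ n = d • (g ^ n * x ^ n) := by
  induction n with
  | zero => exact ⟨1, by simp⟩
  | succ n ih =>
    obtain ⟨d, hd⟩ := ih
    refine ⟨d * c ^ n, ?_⟩
    rw [pow_succ, hd, smul_mul_assoc, mul_assoc, ← mul_assoc (x ^ n), pow_mul_of_qcomm h,
      smul_mul_assoc, mul_smul_comm, smul_smul, pow_succ g, pow_succ x]
    simp only [mul_assoc]

theorem serre_add {c : ℂ} (hc : c ≠ 0) {x₁ x₂ y₁ y₂ : A}
    (hx : x₂ * x₁ = (c⁻¹ * c⁻¹) • (x₁ * x₂)) (h21 : x₂ * y₁ = c • (y₁ * x₂))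
    (h12 : y₂ * x₁ = c • (x₁ * y₂))
    (s₁ : x₁ ^ 2 * y₁ - (c + c⁻¹) • (x₁ * y₁ * x₁) + y₁ * x₁ ^ 2 = 0)
    (s₂ : x₂ ^ 2 * y₂ - (c + c⁻¹) • (x₂ * y₂ * x₂) + y₂ * x₂ ^ 2 = 0) :
    (x₁ + x₂) ^ 2 * (y₁ + y₂) - (c + c⁻¹) • ((x₁ + x₂) * (y₁ + y₂) * (x₁ + x₂))
      + (y₁ + y₂) * (x₁ + x₂) ^ 2 = 0 := by
  have hx' (z : A) : x₂ * (x₁ * z) = (c⁻¹ * c⁻¹) • (x₁ * (x₂ * z)) := by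
    rw [← mul_assoc, hx, smul_mul_assoc, mul_assoc]
  have h21' (z : A) : x₂ * (y₁ * z) = c • (y₁ * (x₂ * z)) := by
    rw [← mul_assoc, h21, smul_mul_assoc, mul_assoc]
  have h12' (z : A) : y₂ * (x₁ * z) = c • (x₁ * (y₂ * z)) := by
    rw [← mul_assoc, h12, smul_mul_assoc, mul_assoc]
  rw [← add_zero (0 : A)]
  nth_rw 1 [← s₁]
  rw [← s₂]
  simp only [pow_two, mul_add, add_mul, mul_assoc, hx, hx', h21, h21', h12, h12', mul_smul_comm,
    smul_mul_assoc, smul_smul, smul_add]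
  match_scalars <;> field_simp <;> ring

theorem serre_twist {c : ℂ} (hc : c ≠ 0) {g₀ g₁ x y : A}
    (hg : g₁ * g₀ = g₀ * g₁) (h00 : x * g₀ = (c⁻¹ * c⁻¹) • (g₀ * x)) (h01 : x * g₁ = c • (g₁ * x))
    (h10 : y * g₀ = c • (g₀ * y))
    (s : x ^ 2 * y - (c + c⁻¹) • (x * y * x) + y * x ^ 2 = 0) :
    (g₀ * x) ^ 2 * (g₁ * y) - (c + c⁻¹) • ((g₀ * x) * (g₁ * y) * (g₀ * x))
      + (g₁ * y) * (g₀ * x) ^ 2 = 0 := by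
  have hg' (z : A) : g₁ * (g₀ * z) = g₀ * (g₁ * z) := by
    rw [← mul_assoc, hg, mul_assoc]
  have h00' (z : A) : x * (g₀ * z) = (c⁻¹ * c⁻¹) • (g₀ * (x * z)) := by
    rw [← mul_assoc, h00, smul_mul_assoc, mul_assoc]
  have h01' (z : A) : x * (g₁ * z) = c • (g₁ * (x * z)) := by
    rw [← mul_assoc, h01, smul_mul_assoc, mul_assoc]
  have h10' (z : A) : y * (g₀ * z) = c • (g₀ * (y * z)) := by
    rw [← mul_assoc, h10, smul_mul_assoc, mul_assoc]
  have : g₀ * g₀ * g₁ * (x ^ 2 * y - (c + c⁻¹) • (x * y * x) + y * x ^ 2) = 0 := by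
    rw [s, mul_zero]
  rw [← this]
  simp only [pow_two, mul_add, mul_sub, add_mul, mul_assoc, hg', h00', h01', h10',
    mul_smul_comm, smul_mul_assoc, smul_smul]
  match_scalars <;> field_simp


end Algebra

/-- The Cartan matrix `(a_{ij})` of `sl(2|1)`. -/
def cartan : Fin 2 → Fin 2 → ℤ := ![![2, -1], ![-1, 0]]

/-- The degrees of `e_1, e_2` (and of `f_1, f_2`): `e_1, f_1` are even and `e_2, f_2` are odd. -/
def parity : Fin 2 → ℕ := ![0, 1]

/-- The defining relations of `U^σ`, for a family of elements of an arbitrary algebra. Used to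
state the universal property of `U^σ`, which is itself constructed from `Rel` below. -/
structure Relations {A : Type*} [Ring A] [Algebra ℂ A] (ξ : ℂ) (l : ℕ)
    (k k' e f : Fin 2 → A) (s : A) : Prop where
  k_comm : k 0 * k 1 = k 1 * k 0
  k_mul_kInv : ∀ i, k i * k' i = 1
  kInv_mul_k : ∀ i, k' i * k i = 1
  k_e : ∀ i j, k i * e j * k' i = ξ ^ cartan i j • e j
  k_f : ∀ i j, k i * f j * k' i = ξ ^ (-cartan i j) • f j
  e_f : ∀ i, e i * f i - (-1 : ℂ) ^ parity i • (f i * e i) = (ξ - ξ⁻¹)⁻¹ • (k i - k' i)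
  e_f_comm : ∀ i j, i ≠ j → e i * f j = f j * e i
  e_sq : e 1 ^ 2 = 0
  f_sq : f 1 ^ 2 = 0
  serre_e : e 0 ^ 2 * e 1 - (ξ + ξ⁻¹) • (e 0 * e 1 * e 0) + e 1 * e 0 ^ 2 = 0
  serre_f : f 0 ^ 2 * f 1 - (ξ + ξ⁻¹) • (f 0 * f 1 * f 0) + f 1 * f 0 ^ 2 = 0
  e_pow : e 0 ^ l = 0
  f_pow : f 0 ^ l = 0
  s_sq : s ^ 2 = 1
  s_k : ∀ i, s * k i = k i * s
  s_e : ∀ i, s * e i = (-1 : ℂ) ^ parity i • (e i * s)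
  s_f : ∀ i, s * f i = (-1 : ℂ) ^ parity i • (f i * s)

namespace Relations

open TensorProduct MulOpposite

variable {A : Type*} [Ring A] [Algebra ℂ A] {ξ : ℂ} {l : ℕ} {k k' e f : Fin 2 → A} {s : A}

theorem kk (h : Relations ξ l k k' e f s) (i j : Fin 2) : k i * k j = k j * k i := by
  fin_cases i <;> fin_cases j <;> simp [h.k_comm]

theorem k'k' (h : Relations ξ l k k' e f s) (i j : Fin 2) : k' i * k' j = k' j * k' i := by
  have e1 : (k' i * k' j) * (k j * k i) = 1 := by
    rw [mul_assoc, ← mul_assoc (k' j), h.kInv_mul_k, one_mul, h.kInv_mul_k]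
  have e2 : (k j * k i) * (k' j * k' i) = 1 := by
    rw [h.kk j i, mul_assoc, ← mul_assoc (k j), h.k_mul_kInv, one_mul, h.k_mul_kInv]
  exact left_inv_eq_right_inv e1 e2

theorem k'_of_k (h : Relations ξ l k k' e f s) {x : A} {c : ℂ} (hc : c ≠ 0) (i : Fin 2) (hx : k i * x = c • (x * k i)) :
    k' i * x = c⁻¹ • (x * k' i) := by
  have : x * k' i = c • (k' i * x) := by
    calc x * k' i = k' i * (k i * x) * k' i := by
          rw [← mul_assoc, h.kInv_mul_k, one_mul]
      _ = _ := by
          rw [hx, mul_smul_comm, smul_mul_assoc, mul_assoc, mul_assoc, h.k_mul_kInv, mul_one]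
  rw [this, smul_smul, inv_mul_cancel₀ hc, one_smul]

theorem kk' (h : Relations ξ l k k' e f s) (i j : Fin 2) : k i * k' j = k' j * k i := by
  have := h.k'_of_k (x := k i) one_ne_zero j (by rw [one_smul, h.kk])
  rw [this, inv_one, one_smul]

theorem sk' (h : Relations ξ l k k' e f s) (i : Fin 2) : s * k' i = k' i * s := by
  have := h.k'_of_k (x := s) one_ne_zero i (by rw [one_smul, h.s_k])
  rw [this, inv_one, one_smul]

theorem ke (h : Relations ξ l k k' e f s) (i j : Fin 2) : k i * e j = ξ ^ cartan i j • (e j * k i) := by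
  rw [← smul_mul_assoc, ← h.k_e, mul_assoc, h.kInv_mul_k, mul_one]

theorem kf (h : Relations ξ l k k' e f s) (i j : Fin 2) : k i * f j = ξ ^ (-cartan i j) • (f j * k i) := by
  rw [← smul_mul_assoc, ← h.k_f, mul_assoc, h.kInv_mul_k, mul_one]

theorem ek (h : Relations ξ l k k' e f s) (hξ : ξ ≠ 0) (i j : Fin 2) : e j * k i = ξ ^ (-cartan i j) • (k i * e j) := by
  rw [h.ke, smul_smul, ← zpow_add₀ hξ]; simp

theorem fk (h : Relations ξ l k k' e f s) (hξ : ξ ≠ 0) (i j : Fin 2) : f j * k i = ξ ^ cartan i j • (k i * f j) := by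
  rw [h.kf, smul_smul, ← zpow_add₀ hξ]; simp

theorem k'e (h : Relations ξ l k k' e f s) (hξ : ξ ≠ 0) (i j : Fin 2) : k' i * e j = ξ ^ (-cartan i j) • (e j * k' i) := by
  rw [zpow_neg]; exact h.k'_of_k (zpow_ne_zero _ hξ) i (h.ke i j)

theorem k'f (h : Relations ξ l k k' e f s) (hξ : ξ ≠ 0) (i j : Fin 2) : k' i * f j = ξ ^ cartan i j • (f j * k' i) := by
  rw [← neg_neg (cartan i j), zpow_neg]; exact h.k'_of_k (zpow_ne_zero _ hξ) i (h.kf i j)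

theorem ek' (h : Relations ξ l k k' e f s) (hξ : ξ ≠ 0) (i j : Fin 2) : e j * k' i = ξ ^ cartan i j • (k' i * e j) := by
  rw [h.k'e hξ, smul_smul, ← zpow_add₀ hξ]; simp

theorem fk' (h : Relations ξ l k k' e f s) (hξ : ξ ≠ 0) (i j : Fin 2) : f j * k' i = ξ ^ (-cartan i j) • (k' i * f j) := by
  rw [h.k'f hξ, smul_smul, ← zpow_add₀ hξ]; simp

theorem es (h : Relations ξ l k k' e f s) (i : Fin 2) : e i * s = (-1 : ℂ) ^ parity i • (s * e i) := by
  rw [h.s_e, smul_smul, ← mul_pow]; simp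

theorem fs (h : Relations ξ l k k' e f s) (i : Fin 2) : f i * s = (-1 : ℂ) ^ parity i • (s * f i) := by
  rw [h.s_f, smul_smul, ← mul_pow]; simp

/-- The relations hold for the images of the generators under the coproduct. -/
theorem tmul (h : Relations ξ l k k' e f s) (hξ : ξ ≠ 0) (hl : 0 < l) (hp : IsPrimitiveRoot (ξ ^ 2) l) :
    Relations ξ l (fun i => k i ⊗ₜ[ℂ] k i) (fun i => k' i ⊗ₜ[ℂ] k' i)
      (fun i => e i ⊗ₜ[ℂ] 1 + (k' i * s ^ parity i) ⊗ₜ[ℂ] e i)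
      (fun i => f i ⊗ₜ[ℂ] k i + (s ^ parity i) ⊗ₜ[ℂ] f i) (s ⊗ₜ[ℂ] s) where
  k_comm := by simp [h.k_comm]
  k_mul_kInv i := by simp [h.k_mul_kInv, Algebra.TensorProduct.one_def]
  kInv_mul_k i := by simp [h.kInv_mul_k, Algebra.TensorProduct.one_def]
  k_e i j := by
    have : k i * (k' j * s ^ parity j) * k' i = k' j * s ^ parity j := by
      have hs : s ^ parity j * k' i = k' i * s ^ parity j := by
        exact (Commute.pow_left (h.sk' i) _)
      rw [mul_assoc, mul_assoc, hs, ← mul_assoc, ← mul_assoc, h.kk', mul_assoc (k' j), h.k_mul_kInv,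
        mul_one]
    simp only [mul_add, add_mul, Algebra.TensorProduct.tmul_mul_tmul, h.k_e, mul_one,
      h.k_mul_kInv, this, smul_add, TensorProduct.tmul_smul, TensorProduct.smul_tmul']
  k_f i j := by
    have : k i * (s ^ parity j) * k' i = s ^ parity j := by
      have hs : s ^ parity j * k' i = k' i * s ^ parity j := by
        exact (Commute.pow_left (h.sk' i) _)
      rw [mul_assoc, hs, ← mul_assoc, h.k_mul_kInv, one_mul]
    have hk : k i * k j * k' i = k j := by
      rw [h.kk, mul_assoc, h.k_mul_kInv, mul_one]
    simp only [mul_add, add_mul, Algebra.TensorProduct.tmul_mul_tmul, h.k_f, hk, this, smul_add,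
      TensorProduct.tmul_smul, TensorProduct.smul_tmul']
  e_f i := by
    have hs : s * s = 1 := by rw [← pow_two, h.s_sq]
    have h1 : e i * f i = (-1 : ℂ) ^ parity i • (f i * e i) + (ξ - ξ⁻¹)⁻¹ • (k i - k' i) := by
      rw [← h.e_f]; abel
    have h2 : k' i * s ^ parity i * f i = ((-1 : ℂ) ^ parity i * ξ ^ cartan i i) •
        (f i * (k' i * s ^ parity i)) := by
      fin_cases i
      · simp [parity, h.k'f hξ]
      · simp [parity, cartan, mul_assoc, h.s_f]
        simp [← mul_assoc, h.k'f hξ, cartan]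
    have h3 : s ^ parity i * e i = (-1 : ℂ) ^ parity i • (e i * s ^ parity i) := by
      fin_cases i
      · simp [parity]
      · simp [parity, h.s_e]
    have h4 : s ^ parity i * (k' i * s ^ parity i) = k' i := by
      fin_cases i
      · simp [parity]
      · simp [parity, ← mul_assoc, h.sk']
        rw [mul_assoc, hs, mul_one]
    have h5 : k' i * s ^ parity i * s ^ parity i = k' i := by
      rw [mul_assoc, ← pow_add]
      fin_cases i
      · simp [parity]
      · simp [parity, h.s_sq]
    have hcc : ξ ^ cartan i i * ξ ^ (-cartan i i) = 1 := by
      rw [← zpow_add₀ hξ]; simp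
    have hp2 : (-1 : ℂ) ^ parity i * (-1 : ℂ) ^ parity i = 1 := by
      rw [← mul_pow]; simp
    simp only [mul_add, add_mul, Algebra.TensorProduct.tmul_mul_tmul, mul_one, one_mul, h1, h2,
      h.ek hξ, h3, h4, h5, TensorProduct.add_tmul, TensorProduct.tmul_add, TensorProduct.sub_tmul,
      TensorProduct.tmul_sub, TensorProduct.tmul_smul,
      smul_add, smul_sub, smul_smul, ← TensorProduct.smul_tmul']
    generalize ξ ^ cartan i i = b at *
    generalize ξ ^ (-cartan i i) = b' at *
    generalize (-1 : ℂ) ^ parity i = a at *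
    match_scalars
    all_goals first | ring1 | linear_combination a * hcc | linear_combination -hp2
  e_f_comm i j hij := by
    have hs : ∀ a b, k' a * s ^ parity b = s ^ parity b * k' a :=
      fun a b => ((Commute.pow_left (h.sk' a) (parity b)).eq).symm
    have h0 := h.e_f_comm i j hij
    have hsym : cartan i j = cartan j i := by fin_cases i <;> fin_cases j <;> simp [cartan]
    have hcc : ξ ^ cartan j i * ξ ^ (-cartan j i) = 1 := by
      rw [← zpow_add₀ hξ]; simp
    have hss : s ^ parity i * s ^ parity j = s ^ parity j * s ^ parity i := by
      rw [← pow_add, ← pow_add, add_comm]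
    have h1 : e i * s ^ parity j = s ^ parity j * e i := by
      fin_cases i <;> fin_cases j <;> simp_all [parity, h.es]
    have h2 : k' i * s ^ parity i * f j = ξ ^ cartan j i • (f j * (k' i * s ^ parity i)) := by
      have hsf : s ^ parity i * f j = f j * s ^ parity i := by
        fin_cases i <;> fin_cases j <;> simp_all [parity, h.s_f]
      rw [mul_assoc, hsf, ← mul_assoc, h.k'f hξ, smul_mul_assoc, mul_assoc, hsym]
    have h3 : k' i * s ^ parity i * s ^ parity j = s ^ parity j * (k' i * s ^ parity i) := by
      rw [mul_assoc, hss, ← mul_assoc, hs, mul_assoc]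
    simp only [mul_add, add_mul, Algebra.TensorProduct.tmul_mul_tmul, mul_one, one_mul, h0, h1, h2,
      h3, h.ek hξ j i, TensorProduct.tmul_smul, smul_smul, ← TensorProduct.smul_tmul', hcc, one_smul,
      mul_comm (ξ ^ (- cartan j i))]
    abel
  e_sq := by
    have hs : s * s = 1 := by rw [← pow_two, h.s_sq]
    have h0 : e 1 * e 1 = 0 := by rw [← pow_two, h.e_sq]
    have h1 : e 1 * (k' 1 * s) = - (k' 1 * s * e 1) := by
      rw [← mul_assoc, h.ek' hξ]; simp [cartan, mul_assoc, h.es, parity]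
    simp [pow_two, mul_add, add_mul, h0, h1, parity, TensorProduct.neg_tmul]
  f_sq := by
    have h0 : f 1 * f 1 = 0 := by rw [← pow_two, h.f_sq]
    have h1 : f 1 * s = - (s * f 1) := by simp [h.fs, parity]
    have h2 : f 1 * k 1 = k 1 * f 1 := by simp [h.fk hξ, cartan]
    simp [pow_two, mul_add, add_mul, h0, h1, h2, parity, TensorProduct.neg_tmul]
  serre_e := by
    have hs : s * e 0 = e 0 * s := by simp [h.s_e, parity]
    have hs' : ∀ z, s * (k' 0 * z) = k' 0 * (s * z) := fun z => by
      rw [← mul_assoc, h.sk', mul_assoc]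
    apply serre_add hξ
    · have hz : ξ ^ (-cartan 0 0) = ξ⁻¹ * ξ⁻¹ := by
        rw [← mul_inv, ← zpow_two, ← zpow_neg]; rfl
      simp [parity, h.k'e hξ 0 0, hz, ← TensorProduct.smul_tmul']
    · simp [parity, h.k'e hξ, cartan, ← TensorProduct.smul_tmul']
    · simp [parity, mul_assoc, hs]
      rw [← mul_assoc, h.k'e hξ, ← mul_assoc]
      simp [cartan, ← TensorProduct.smul_tmul']
    · simpa [parity, TensorProduct.smul_tmul', ← TensorProduct.sub_tmul, ← TensorProduct.add_tmul, pow_two]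
        using congrArg (fun z => z ⊗ₜ[ℂ] (1 : A)) h.serre_e
    · have a1 : k' 1 * s * k' 0 = k' 0 * (k' 1 * s) := by
        rw [mul_assoc, h.sk', ← mul_assoc, h.k'k', mul_assoc]
      have a2 : k' 1 * s * (k' 0 * k' 0) = k' 0 * k' 0 * (k' 1 * s) := by
        rw [← mul_assoc, a1, mul_assoc, a1, mul_assoc]
      have a3 : k' 0 * (k' 1 * s) * k' 0 = k' 0 * k' 0 * (k' 1 * s) := by
        rw [mul_assoc, a1, mul_assoc]
      have := congrArg (fun z => (k' 0 * k' 0 * (k' 1 * s)) ⊗ₜ[ℂ] z) h.serre_e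
      simp only [TensorProduct.tmul_add, TensorProduct.tmul_sub, TensorProduct.tmul_smul,
        TensorProduct.tmul_zero, pow_two] at this
      simp only [parity, Matrix.cons_val_zero, Matrix.cons_val_one, pow_zero, pow_one, mul_one,
        pow_two, Algebra.TensorProduct.tmul_mul_tmul, a2, a3]
      exact this
  serre_f := by
    have hs : s * f 0 = f 0 * s := by simp [h.s_f, parity]
    have hc : ξ + ξ⁻¹ = ξ⁻¹ + ξ⁻¹⁻¹ := by rw [inv_inv, add_comm]
    rw [hc]
    apply serre_add (inv_ne_zero hξ)
    · simp [parity, h.fk hξ, cartan]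
      congr 1
      exact pow_two ξ
    · simp [parity, h.fk hξ, cartan]
    · simp [parity, h.fk hξ, cartan, hs]
    · have a1 : k 1 * (k 0 * k 0) = k 0 * k 0 * k 1 := by
        rw [← mul_assoc, ← h.k_comm, mul_assoc, ← h.k_comm, mul_assoc]
      have a2 : k 0 * k 1 * k 0 = k 0 * k 0 * k 1 := by
        rw [mul_assoc, ← h.k_comm, mul_assoc]
      have := congrArg (fun z => z ⊗ₜ[ℂ] (k 0 * k 0 * k 1)) h.serre_f
      simp only [TensorProduct.add_tmul, TensorProduct.sub_tmul, ← TensorProduct.smul_tmul',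
        TensorProduct.zero_tmul, pow_two] at this
      simp only [pow_two, Algebra.TensorProduct.tmul_mul_tmul, a1, a2, ← hc]
      exact this
    · have := congrArg (fun z => s ⊗ₜ[ℂ] z) h.serre_f
      simp only [TensorProduct.tmul_add, TensorProduct.tmul_sub, TensorProduct.tmul_smul,
        TensorProduct.tmul_zero, pow_two] at this
      simp only [parity, Matrix.cons_val_zero, Matrix.cons_val_one, pow_zero, pow_one, mul_one,
        pow_two, Algebra.TensorProduct.tmul_mul_tmul, one_mul, ← hc]
      exact this
  e_pow := by
    have hq : IsPrimitiveRoot (ξ ^ 2)⁻¹ l := hp.inv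
    rw [add_pow_primitive hq hl]
    · simp [Algebra.TensorProduct.tmul_pow, h.e_pow]
    · simp [parity, h.k'e hξ, cartan, ← TensorProduct.smul_tmul']
  f_pow := by
    rw [add_pow_primitive hp hl]
    · simp [Algebra.TensorProduct.tmul_pow, h.f_pow]
    · simp [parity, h.fk hξ, cartan]
  s_sq := by simp [h.s_sq, Algebra.TensorProduct.one_def]
  s_k i := by simp [h.s_k]
  s_e i := by
    have : s * (k' i * s ^ parity i) = k' i * s ^ parity i * s := by
      rw [← mul_assoc, h.sk', mul_assoc, mul_assoc, ← pow_succ, ← pow_succ']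
    simp [mul_add, add_mul, h.s_e, this, ← TensorProduct.smul_tmul']
  s_f i := by
    have : s * s ^ parity i = s ^ parity i * s := by
      rw [← pow_succ, ← pow_succ']
    simp [mul_add, add_mul, h.s_f, h.s_k, this, ← TensorProduct.smul_tmul']

/-- The relations hold, in the opposite algebra, for the images of the generators under the
antipode. -/
theorem antipode (h : Relations ξ l k k' e f s) (hξ : ξ ≠ 0) :
    Relations ξ l (fun i => op (k' i)) (fun i => op (k i))
      (fun i => op (-(s ^ parity i * k i * e i))) (fun i => op (-(s ^ parity i * f i * k' i)))
      (op s) where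
  k_comm := by simp [← op_mul, h.k'k' 0 1]
  k_mul_kInv i := by simp [← op_mul, h.k_mul_kInv]
  kInv_mul_k i := by simp [← op_mul, h.kInv_mul_k]
  k_e i j := by
    apply unop_injective
    simp only [unop_mul, unop_op, unop_smul, mul_neg, neg_mul, smul_neg]
    congr 1
    have hs : k i * s ^ parity j = s ^ parity j * k i :=
      (Commute.pow_left (h.s_k i) (parity j)).symm
    simp only [← mul_assoc]
    rw [hs, mul_assoc (s ^ _), h.kk i j, mul_assoc, mul_assoc, mul_assoc, ← mul_assoc (k i), h.k_e,
      mul_smul_comm, mul_smul_comm, ← mul_assoc]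
  k_f i j := by
    apply unop_injective
    simp only [unop_mul, unop_op, unop_smul, mul_neg, neg_mul, smul_neg]
    congr 1
    have hs : k i * s ^ parity j = s ^ parity j * k i :=
      (Commute.pow_left (h.s_k i) (parity j)).symm
    simp only [← mul_assoc]
    rw [hs, mul_assoc _ (k' j), h.k'k', ← mul_assoc, mul_assoc (s ^ _), mul_assoc (s ^ _), h.k_f,
      mul_smul_comm, smul_mul_assoc]
  e_f i := by
    apply unop_injective
    simp only [unop_mul, unop_op, unop_smul, unop_sub, neg_mul_neg]
    have hs : s * s = 1 := by rw [← pow_two, h.s_sq]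
    have hsk : k' i * s ^ parity i = s ^ parity i * k' i :=
      (Commute.pow_left (h.sk' i) (parity i)).symm
    have hsk2 : s ^ parity i * k i = k i * s ^ parity i :=
      (Commute.pow_left (h.s_k i) (parity i))
    have hss : s ^ parity i * s ^ parity i = 1 := by
      rw [← (Commute.refl s).mul_pow, hs, one_pow]
    have hsf : s ^ parity i * f i = (-1 : ℂ) ^ parity i • (f i * s ^ parity i) := by
      fin_cases i <;> simp [parity, h.s_f]
    have hes : e i * s ^ parity i = (-1 : ℂ) ^ parity i • (s ^ parity i * e i) := by
      fin_cases i <;> simp [parity, h.es]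
    have hX : s ^ parity i * f i * k' i * (s ^ parity i * k i * e i)
        = (-1 : ℂ) ^ parity i • (f i * e i) := by
      calc _ = s ^ parity i * f i * (k' i * s ^ parity i) * k i * e i := by simp only [mul_assoc]
        _ = s ^ parity i * f i * s ^ parity i * (k' i * k i) * e i := by
          rw [hsk]; simp only [mul_assoc]
        _ = _ := by
          rw [h.kInv_mul_k, hsf, smul_mul_assoc, mul_assoc (f i), hss, mul_one, mul_one,
            smul_mul_assoc]
    have hY : s ^ parity i * k i * e i * (s ^ parity i * f i * k' i)
        = (-1 : ℂ) ^ parity i • (e i * f i) := by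
      calc _ = (s ^ parity i * k i) * (e i * s ^ parity i) * (f i * k' i) := by
            simp only [mul_assoc]
        _ = (-1 : ℂ) ^ parity i • (k i * (s ^ parity i * s ^ parity i) * e i * (f i * k' i)) := by
          rw [hsk2, hes, mul_smul_comm, smul_mul_assoc]; simp only [mul_assoc]
        _ = (-1 : ℂ) ^ parity i • ((k i * e i) * (f i * k' i)) := by rw [hss, mul_one]
        _ = _ := by
          rw [h.ke, h.fk' hξ, smul_mul_smul_comm, ← zpow_add₀ hξ, mul_assoc, ← mul_assoc (k i),
            h.k_mul_kInv, one_mul]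
          simp
    have hp2 : (-1 : ℂ) ^ parity i * (-1 : ℂ) ^ parity i = 1 := by
      rw [← mul_pow]; simp
    rw [hX, hY, smul_smul, hp2, one_smul, ← neg_sub (k i), smul_neg, ← h.e_f]
    abel
  e_f_comm i j hij := by
    apply unop_injective
    simp only [unop_mul, unop_op, neg_mul_neg]
    have hsym : cartan i j = cartan j i := by fin_cases i <;> fin_cases j <;> simp [cartan]
    have hsf : f j * s ^ parity i = s ^ parity i * f j := by
      fin_cases i <;> fin_cases j <;> simp_all [parity, h.s_f]
    have hes : e i * s ^ parity j = s ^ parity j * e i := by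
      fin_cases i <;> fin_cases j <;> simp_all [parity, h.es]
    have hsk : k' j * s ^ parity i = s ^ parity i * k' j :=
      (Commute.pow_left (h.sk' j) (parity i)).symm
    have hsk2 : k i * s ^ parity j = s ^ parity j * k i :=
      (Commute.pow_left (h.s_k i) (parity j)).symm
    have hss : s ^ parity i * s ^ parity j = s ^ parity j * s ^ parity i := by
      rw [← pow_add, ← pow_add, add_comm]
    calc _ = s ^ parity j * f j * (k' j * s ^ parity i) * (k i * e i) := by simp only [mul_assoc]
      _ = s ^ parity j * (f j * s ^ parity i) * (k' j * k i) * e i := by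
        rw [hsk]; simp only [mul_assoc]
      _ = s ^ parity j * s ^ parity i * (f j * k i) * (k' j * e i) := by
        rw [hsf, ← h.kk']; simp only [mul_assoc]
      _ = s ^ parity i * s ^ parity j * (k i * f j) * (e i * k' j) := by
        rw [h.fk hξ, h.k'e hξ, ← hss, mul_smul_comm, mul_smul_comm, smul_mul_assoc, smul_smul,
          ← zpow_add₀ hξ, hsym]
        simp
      _ = s ^ parity i * (s ^ parity j * k i) * (f j * e i) * k' j := by simp only [mul_assoc]
      _ = s ^ parity i * k i * (s ^ parity j * e i) * f j * k' j := by
        rw [← hsk2, ← h.e_f_comm i j hij]; simp only [mul_assoc]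
      _ = _ := by rw [← hes]; simp only [mul_assoc]
  e_sq := by
    apply unop_injective
    have h1 : e 1 * (s * k 1) = (-1 : ℂ) • (s * k 1 * e 1) := by
      rw [← mul_assoc, h.es, smul_mul_assoc, mul_assoc, h.ek hξ, mul_smul_comm, mul_assoc]
      simp [parity, cartan]
    obtain ⟨d, hd⟩ := qcomm_mul_pow h1 2
    simp [parity, hd, h.e_sq]
  f_sq := by
    apply unop_injective
    have h0 : s * f 1 * k' 1 = s * k' 1 * f 1 := by
      rw [mul_assoc, h.fk' hξ, mul_smul_comm, mul_assoc]; simp [cartan]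
    have h1 : f 1 * (s * k' 1) = (-1 : ℂ) • (s * k' 1 * f 1) := by
      rw [← mul_assoc, h.fs, smul_mul_assoc, h0]
      simp [parity]
    obtain ⟨d, hd⟩ := qcomm_mul_pow h1 2
    simp [parity, h0, hd, h.f_sq]
  serre_e := by
    apply unop_injective
    have hz : ξ ^ (-cartan 0 0) = ξ⁻¹ * ξ⁻¹ := by
      rw [← mul_inv, ← zpow_two, ← zpow_neg]; rfl
    have h1 : s * k 1 * k 0 = k 0 * (s * k 1) := by
      rw [mul_assoc, ← h.k_comm, ← mul_assoc, h.s_k, mul_assoc]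
    have h2 : e 0 * (s * k 1) = ξ • (s * k 1 * e 0) := by
      rw [← mul_assoc, h.es, smul_mul_assoc, mul_assoc, h.ek hξ, mul_smul_comm, mul_assoc]
      simp [parity, cartan]
    have h3 : e 1 * k 0 = ξ • (k 0 * e 1) := by
      rw [h.ek hξ]; simp [cartan]
    have := serre_twist hξ h1 (by rw [h.ek hξ, hz]) h2 h3 h.serre_e
    simp only [parity, Matrix.cons_val_zero, Matrix.cons_val_one, pow_zero, pow_one, one_mul,
      unop_add, unop_sub, unop_mul, unop_smul, unop_op, unop_zero, pow_two, neg_mul, mul_neg,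
      neg_neg, smul_neg] at this ⊢
    refine Eq.trans ?_ (neg_eq_zero.mpr this)
    simp only [mul_assoc]
    module
  serre_f := by
    apply unop_injective
    have hc : ξ + ξ⁻¹ = ξ⁻¹ + ξ⁻¹⁻¹ := by rw [inv_inv, add_comm]
    have hz : ξ ^ cartan 0 0 = ξ⁻¹⁻¹ * ξ⁻¹⁻¹ := by
      rw [inv_inv, ← zpow_two]; rfl
    have h1 : s * k' 1 * k' 0 = k' 0 * (s * k' 1) := by
      rw [mul_assoc, h.k'k', ← mul_assoc, h.sk', mul_assoc]
    have hz' : f 0 * k' 0 = (ξ * ξ)⁻¹ • (k' 0 * f 0) := by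
      rw [h.fk' hξ, zpow_neg, hz, inv_inv]
    have h2 : f 0 * (s * k' 1) = ξ • (s * k' 1 * f 0) := by
      rw [← mul_assoc, h.fs, smul_mul_assoc, mul_assoc, h.fk' hξ, mul_smul_comm, mul_assoc]
      simp [parity, cartan]
    have h3 : f 1 * k' 0 = ξ • (k' 0 * f 1) := by
      rw [h.fk' hξ]; simp [cartan]
    have h4 : s * f 1 * k' 1 = s * k' 1 * f 1 := by
      rw [mul_assoc, h.fk' hξ, mul_smul_comm, mul_assoc]; simp [cartan]
    have := serre_twist hξ h1 (by rw [hz', mul_inv]) h2 h3 h.serre_f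
    simp only [parity, Matrix.cons_val_zero, Matrix.cons_val_one, pow_zero, pow_one, one_mul,
      unop_add, unop_sub, unop_mul, unop_smul, unop_op, unop_zero, pow_two, neg_mul, mul_neg,
      neg_neg, smul_neg, h4, hz'] at this ⊢
    refine Eq.trans ?_ ((congrArg (fun z => -(((ξ * ξ)⁻¹ * (ξ * ξ)⁻¹) • z)) this).trans (by simp))
    simp only [smul_mul_assoc, mul_smul_comm, smul_smul, mul_assoc]
    module
  e_pow := by
    apply unop_injective
    obtain ⟨d, hd⟩ := qcomm_mul_pow (h.ek hξ 0 0) l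
    simp [parity, neg_pow (k 0 * e 0), hd, h.e_pow]
  f_pow := by
    apply unop_injective
    obtain ⟨d, hd⟩ := qcomm_mul_pow (h.k'f hξ 0 0) l
    simp [parity, neg_pow (f 0 * k' 0), hd, h.f_pow]
  s_sq := by simp [← op_pow, h.s_sq]
  s_k i := by simp [← op_mul, h.sk']
  s_e i := by
    apply unop_injective
    have hs : ∀ z, s * (s ^ parity i * z) = s ^ parity i * (s * z) := fun z => by
      rw [← mul_assoc, ← pow_succ', pow_succ, mul_assoc]
    simp [mul_assoc, h.es, hs]
    rw [← mul_assoc s, h.s_k, mul_assoc]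
  s_f i := by
    apply unop_injective
    have hs : ∀ z, s * (s ^ parity i * z) = s ^ parity i * (s * z) := fun z => by
      rw [← mul_assoc, ← pow_succ', pow_succ, mul_assoc]
    simp [mul_assoc, hs, ← h.sk']
    rw [← mul_assoc (f i), h.fs]
    simp [mul_assoc]

end Relations

/-! ## The Hopf algebra `U^σ` -/

/-- The root of unity `ξ = exp (2πi/ℓ)`. -/
noncomputable def xi (l : ℕ) : ℂ := Complex.exp (2 * Real.pi * Complex.I / l)

theorem xi_ne_zero (l : ℕ) : xi l ≠ 0 := Complex.exp_ne_zero _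

theorem xi_sq_primitive (l : ℕ) (hl : Odd l) : IsPrimitiveRoot (xi l ^ 2) l :=
  (Complex.isPrimitiveRoot_exp l hl.pos.ne').pow_of_coprime 2 (Nat.coprime_two_left.mpr hl)

/-- Names of the generators; the index `0 : Fin 2` stands for the subscript `1` (even generators)
and `1 : Fin 2` for the subscript `2` (odd generators). -/
inductive Gen : Type
  | k (i : Fin 2)
  | kInv (i : Fin 2)
  | e (i : Fin 2)
  | f (i : Fin 2)
  | s

namespace Free

noncomputable def k (i : Fin 2) : FreeAlgebra ℂ Gen := FreeAlgebra.ι ℂ (Gen.k i)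
noncomputable def kInv (i : Fin 2) : FreeAlgebra ℂ Gen := FreeAlgebra.ι ℂ (Gen.kInv i)
noncomputable def e (i : Fin 2) : FreeAlgebra ℂ Gen := FreeAlgebra.ι ℂ (Gen.e i)
noncomputable def f (i : Fin 2) : FreeAlgebra ℂ Gen := FreeAlgebra.ι ℂ (Gen.f i)
noncomputable def s : FreeAlgebra ℂ Gen := FreeAlgebra.ι ℂ Gen.s

end Free

open Free in
/-- The defining relations of `U^σ`, the bosonization of the quotient of the quantum superalgebra
`U_ξ sl(2|1)` by `e_1^ℓ` and `f_1^ℓ`. The generator `s` is the element `σ` with `σ² = 1` and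
`σ x = (-1)^{deg x} x σ`. -/
inductive Rel (l : ℕ) : FreeAlgebra ℂ Gen → FreeAlgebra ℂ Gen → Prop
  | k_comm : Rel l (k 0 * k 1) (k 1 * k 0)
  | k_mul_kInv (i : Fin 2) : Rel l (k i * kInv i) 1
  | kInv_mul_k (i : Fin 2) : Rel l (kInv i * k i) 1
  | k_e (i j : Fin 2) : Rel l (k i * e j * kInv i) (xi l ^ cartan i j • e j)
  | k_f (i j : Fin 2) : Rel l (k i * f j * kInv i) (xi l ^ (-cartan i j) • f j)
  | e_f (i : Fin 2) : Rel l (e i * f i - (-1 : ℂ) ^ parity i • (f i * e i))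
      ((xi l - (xi l)⁻¹)⁻¹ • (k i - kInv i))
  | e_f_comm (i j : Fin 2) (hij : i ≠ j) : Rel l (e i * f j) (f j * e i)
  | e_sq : Rel l (e 1 ^ 2) 0
  | f_sq : Rel l (f 1 ^ 2) 0
  | serre_e : Rel l
      (e 0 ^ 2 * e 1 - (xi l + (xi l)⁻¹) • (e 0 * e 1 * e 0) + e 1 * e 0 ^ 2) 0
  | serre_f : Rel l
      (f 0 ^ 2 * f 1 - (xi l + (xi l)⁻¹) • (f 0 * f 1 * f 0) + f 1 * f 0 ^ 2) 0
  | e_pow : Rel l (e 0 ^ l) 0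
  | f_pow : Rel l (f 0 ^ l) 0
  | s_sq : Rel l (s ^ 2) 1
  | s_k (i : Fin 2) : Rel l (s * k i) (k i * s)
  | s_e (i : Fin 2) : Rel l (s * e i) ((-1 : ℂ) ^ parity i • (e i * s))
  | s_f (i : Fin 2) : Rel l (s * f i) ((-1 : ℂ) ^ parity i • (f i * s))

/-- The algebra `U^σ`. -/
def Usigma (l : ℕ) : Type := RingQuot (Rel l)

namespace Usigma

open TensorProduct MulOpposite

noncomputable instance (l : ℕ) : Ring (Usigma l) := inferInstanceAs (Ring (RingQuot (Rel l)))

noncomputable instance (l : ℕ) : Algebra ℂ (Usigma l) :=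
  inferInstanceAs (Algebra ℂ (RingQuot (Rel l)))

/-- The projection from the free algebra. -/
noncomputable def proj (l : ℕ) : FreeAlgebra ℂ Gen →ₐ[ℂ] Usigma l := RingQuot.mkAlgHom ℂ (Rel l)

noncomputable def gen (l : ℕ) (x : Gen) : Usigma l := proj l (FreeAlgebra.ι ℂ x)

noncomputable def k (l : ℕ) (i : Fin 2) : Usigma l := gen l (Gen.k i)
noncomputable def kInv (l : ℕ) (i : Fin 2) : Usigma l := gen l (Gen.kInv i)
noncomputable def e (l : ℕ) (i : Fin 2) : Usigma l := gen l (Gen.e i)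
noncomputable def f (l : ℕ) (i : Fin 2) : Usigma l := gen l (Gen.f i)
noncomputable def s (l : ℕ) : Usigma l := gen l Gen.s

theorem proj_rel {l : ℕ} {x y : FreeAlgebra ℂ Gen} (h : Rel l x y) : proj l x = proj l y :=
  RingQuot.mkAlgHom_rel ℂ h

theorem relations (l : ℕ) : Relations (xi l) l (k l) (kInv l) (e l) (f l) (s l) where
  k_comm := by simpa using! proj_rel (Rel.k_comm (l := l))
  k_mul_kInv i := by simpa using! proj_rel (Rel.k_mul_kInv (l := l) i)
  kInv_mul_k i := by simpa using! proj_rel (Rel.kInv_mul_k (l := l) i)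
  k_e i j := by simpa using! proj_rel (Rel.k_e (l := l) i j)
  k_f i j := by simpa using! proj_rel (Rel.k_f (l := l) i j)
  e_f i := by simpa using! proj_rel (Rel.e_f (l := l) i)
  e_f_comm i j h := by simpa using! proj_rel (Rel.e_f_comm (l := l) i j h)
  e_sq := by simpa using! proj_rel (Rel.e_sq (l := l))
  f_sq := by simpa using! proj_rel (Rel.f_sq (l := l))
  serre_e := by simpa using! proj_rel (Rel.serre_e (l := l))
  serre_f := by simpa using! proj_rel (Rel.serre_f (l := l))
  e_pow := by simpa using! proj_rel (Rel.e_pow (l := l))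
  f_pow := by simpa using! proj_rel (Rel.f_pow (l := l))
  s_sq := by simpa using! proj_rel (Rel.s_sq (l := l))
  s_k i := by simpa using! proj_rel (Rel.s_k (l := l) i)
  s_e i := by simpa using! proj_rel (Rel.s_e (l := l) i)
  s_f i := by simpa using! proj_rel (Rel.s_f (l := l) i)

section lift

variable {A : Type*} [Ring A] [Algebra ℂ A] {l : ℕ} {k' kInv' e' f' : Fin 2 → A} {s' : A}

/-- The universal property of `U^σ`. -/
noncomputable def lift (h : Relations (xi l) l k' kInv' e' f' s') : Usigma l →ₐ[ℂ] A :=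
  RingQuot.liftAlgHom ℂ ⟨FreeAlgebra.lift ℂ (fun x => match x with
    | Gen.k i => k' i
    | Gen.kInv i => kInv' i
    | Gen.e i => e' i
    | Gen.f i => f' i
    | Gen.s => s'), by
    intro x y hxy
    cases hxy <;> simp [Free.k, Free.kInv, Free.e, Free.f, Free.s, -zpow_neg]
    · exact h.k_comm
    · exact h.k_mul_kInv _
    · exact h.kInv_mul_k _
    · exact h.k_e _ _
    · exact h.k_f _ _
    · exact h.e_f _
    · exact h.e_f_comm _ _ ‹_›
    · exact h.e_sq
    · exact h.f_sq
    · exact h.serre_e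
    · exact h.serre_f
    · exact h.e_pow
    · exact h.f_pow
    · exact h.s_sq
    · exact h.s_k _
    · exact h.s_e _
    · exact h.s_f _⟩

variable (h : Relations (xi l) l k' kInv' e' f' s')

@[simp] theorem lift_k (i : Fin 2) : lift h (k l i) = k' i := by
  exact (RingQuot.liftAlgHom_mkAlgHom_apply ..).trans (by simp)
@[simp] theorem lift_kInv (i : Fin 2) : lift h (kInv l i) = kInv' i := by
  exact (RingQuot.liftAlgHom_mkAlgHom_apply ..).trans (by simp)
@[simp] theorem lift_e (i : Fin 2) : lift h (e l i) = e' i := by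
  exact (RingQuot.liftAlgHom_mkAlgHom_apply ..).trans (by simp)
@[simp] theorem lift_f (i : Fin 2) : lift h (f l i) = f' i := by
  exact (RingQuot.liftAlgHom_mkAlgHom_apply ..).trans (by simp)
@[simp] theorem lift_s : lift h (s l) = s' := by
  exact (RingQuot.liftAlgHom_mkAlgHom_apply ..).trans (by simp)

end lift

theorem algHom_ext {A : Type*} [Semiring A] [Algebra ℂ A] {l : ℕ} {φ ψ : Usigma l →ₐ[ℂ] A}
    (hk : ∀ i, φ (k l i) = ψ (k l i)) (hk' : ∀ i, φ (kInv l i) = ψ (kInv l i))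
    (he : ∀ i, φ (e l i) = ψ (e l i)) (hf : ∀ i, φ (f l i) = ψ (f l i))
    (hs : φ (s l) = ψ (s l)) : φ = ψ := by
  apply RingQuot.ringQuot_ext' ℂ (s := Rel l)
  apply FreeAlgebra.hom_ext
  funext x
  cases x with
  | k i => exact hk i
  | kInv i => exact hk' i
  | e i => exact he i
  | f i => exact hf i
  | s => exact hs

theorem induction {l : ℕ} {P : Usigma l → Prop} (halg : ∀ c : ℂ, P (algebraMap ℂ _ c))
    (hadd : ∀ x y, P x → P y → P (x + y)) (hmul : ∀ x y, P x → P y → P (x * y))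
    (hk : ∀ i, P (k l i)) (hk' : ∀ i, P (kInv l i)) (he : ∀ i, P (e l i)) (hf : ∀ i, P (f l i))
    (hs : P (s l)) (x : Usigma l) : P x := by
  obtain ⟨y, rfl⟩ := RingQuot.mkAlgHom_surjective ℂ (Rel l) x
  change P (proj l y)
  induction y with
  | grade0 c => rw [AlgHom.commutes]; exact halg c
  | grade1 x =>
    cases x with
    | k i => exact hk i
    | kInv i => exact hk' i
    | e i => exact he i
    | f i => exact hf i
    | s => exact hs
  | mul a b ha hb => rw [map_mul]; exact hmul _ _ ha hb
  | add a b ha hb => rw [map_add]; exact hadd _ _ ha hb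


/-- The coproduct `Δ^σ`: `k_i ↦ k_i ⊗ k_i`, `e_i ↦ e_i ⊗ 1 + k_i⁻¹ σ^{|i|} ⊗ e_i`,
`f_i ↦ f_i ⊗ k_i + σ^{|i|} ⊗ f_i`, `σ ↦ σ ⊗ σ`, where `|i|` is the parity of `e_i` and `f_i`. -/
noncomputable def comulHom (l : ℕ) [hl : Fact (Odd l)] : Usigma l →ₐ[ℂ] Usigma l ⊗[ℂ] Usigma l :=
  lift (k' := fun i => k l i ⊗ₜ[ℂ] k l i) (kInv' := fun i => kInv l i ⊗ₜ[ℂ] kInv l i)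
    (e' := fun i => e l i ⊗ₜ[ℂ] 1 + (kInv l i * s l ^ parity i) ⊗ₜ[ℂ] e l i)
    (f' := fun i => f l i ⊗ₜ[ℂ] k l i + (s l ^ parity i) ⊗ₜ[ℂ] f l i)
    (s' := s l ⊗ₜ[ℂ] s l)
    ((relations l).tmul (xi_ne_zero l) hl.out.pos (xi_sq_primitive l hl.out))

theorem trivial_relations (l : ℕ) [hl : Fact (Odd l)] : Relations (A := ℂ) (xi l) l 1 1 0 0 1 := by
  have h0 : l ≠ 0 := hl.out.pos.ne'
  constructor <;> simp [h0]

/-- The counit `ε^σ`: `k_i, σ ↦ 1`, `e_i, f_i ↦ 0`. -/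
noncomputable def counitHom (l : ℕ) [hl : Fact (Odd l)] : Usigma l →ₐ[ℂ] ℂ :=
  lift (k' := 1) (kInv' := 1) (e' := 0) (f' := 0) (s' := 1) (trivial_relations l)

/-- The antipode `S^σ`, as a homomorphism to the opposite algebra: `k_i ↦ k_i⁻¹`,
`e_i ↦ -σ^{|i|} k_i e_i`, `f_i ↦ -σ^{|i|} f_i k_i⁻¹`, `σ ↦ σ`. -/
noncomputable def antipodeHom (l : ℕ) : Usigma l →ₐ[ℂ] (Usigma l)ᵐᵒᵖ :=
  lift (k' := fun i => op (kInv l i)) (kInv' := fun i => op (k l i))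
    (e' := fun i => op (-(s l ^ parity i * k l i * e l i)))
    (f' := fun i => op (-(s l ^ parity i * f l i * kInv l i)))
    (s' := op (s l)) ((relations l).antipode (xi_ne_zero l))

noncomputable instance (l : ℕ) [Fact (Odd l)] : Bialgebra ℂ (Usigma l) :=
  Bialgebra.ofAlgHom (comulHom l) (counitHom l)
    (by
      apply algHom_ext
      · intro i; simp [comulHom]
      · intro i; simp [comulHom]
      · intro i; simp [comulHom, tmul_add, add_tmul, Algebra.TensorProduct.one_def, add_assoc]
      · intro i; simp [comulHom, tmul_add, add_tmul, add_assoc]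
      · simp [comulHom])
    (by
      apply algHom_ext
      · intro i; simp [comulHom, counitHom]
      · intro i; simp [comulHom, counitHom]
      · intro i; simp [comulHom, counitHom]
      · intro i; simp [comulHom, counitHom]
      · simp [comulHom, counitHom])
    (by
      apply algHom_ext
      · intro i; simp [comulHom, counitHom]
      · intro i; simp [comulHom, counitHom]
      · intro i; simp [comulHom, counitHom]
      · intro i; simp [comulHom, counitHom]
      · simp [comulHom, counitHom])

theorem comul_k (l : ℕ) [Fact (Odd l)] (i : Fin 2) :
    Coalgebra.comul (R := ℂ) (k l i) = k l i ⊗ₜ[ℂ] k l i :=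
  lift_k _ i

theorem comul_kInv (l : ℕ) [Fact (Odd l)] (i : Fin 2) :
    Coalgebra.comul (R := ℂ) (kInv l i) = kInv l i ⊗ₜ[ℂ] kInv l i :=
  lift_kInv _ i

theorem comul_e (l : ℕ) [Fact (Odd l)] (i : Fin 2) :
    Coalgebra.comul (R := ℂ) (e l i)
      = e l i ⊗ₜ[ℂ] 1 + (kInv l i * s l ^ parity i) ⊗ₜ[ℂ] e l i :=
  lift_e _ i

theorem comul_f (l : ℕ) [Fact (Odd l)] (i : Fin 2) :
    Coalgebra.comul (R := ℂ) (f l i) = f l i ⊗ₜ[ℂ] k l i + (s l ^ parity i) ⊗ₜ[ℂ] f l i :=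
  lift_f _ i

theorem comul_s (l : ℕ) [Fact (Odd l)] :
    Coalgebra.comul (R := ℂ) (s l) = s l ⊗ₜ[ℂ] s l :=
  lift_s _

theorem counit_k (l : ℕ) [Fact (Odd l)] (i : Fin 2) :
    Coalgebra.counit (R := ℂ) (k l i) = 1 :=
  lift_k _ i

theorem counit_kInv (l : ℕ) [Fact (Odd l)] (i : Fin 2) :
    Coalgebra.counit (R := ℂ) (kInv l i) = 1 :=
  lift_kInv _ i

theorem counit_e (l : ℕ) [Fact (Odd l)] (i : Fin 2) :
    Coalgebra.counit (R := ℂ) (e l i) = 0 :=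
  lift_e _ i

theorem counit_f (l : ℕ) [Fact (Odd l)] (i : Fin 2) :
    Coalgebra.counit (R := ℂ) (f l i) = 0 :=
  lift_f _ i

theorem counit_s (l : ℕ) [Fact (Odd l)] : Coalgebra.counit (R := ℂ) (s l) = 1 :=
  lift_s _

/-- The antipode as a linear map. -/
noncomputable def antipodeLin (l : ℕ) : Usigma l →ₗ[ℂ] Usigma l :=
  (opLinearEquiv ℂ).symm.toLinearMap ∘ₗ (antipodeHom l).toLinearMap

theorem antipodeLin_mul (l : ℕ) (x y : Usigma l) :
    antipodeLin l (x * y) = antipodeLin l y * antipodeLin l x := by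
  simp [antipodeLin]

theorem antipodeLin_algebraMap (l : ℕ) (c : ℂ) :
    antipodeLin l (algebraMap ℂ _ c) = algebraMap ℂ _ c := by
  simp [antipodeLin]

theorem antipodeLin_k (l : ℕ) (i : Fin 2) : antipodeLin l (k l i) = kInv l i := by
  simp [antipodeLin, antipodeHom]

theorem antipodeLin_kInv (l : ℕ) (i : Fin 2) : antipodeLin l (kInv l i) = k l i := by
  simp [antipodeLin, antipodeHom]

theorem antipodeLin_e (l : ℕ) (i : Fin 2) :
    antipodeLin l (e l i) = -(s l ^ parity i * k l i * e l i) := by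
  simp [antipodeLin, antipodeHom]

theorem antipodeLin_f (l : ℕ) (i : Fin 2) :
    antipodeLin l (f l i) = -(s l ^ parity i * f l i * kInv l i) := by
  simp [antipodeLin, antipodeHom]

theorem antipodeLin_s (l : ℕ) : antipodeLin l (s l) = s l := by
  simp [antipodeLin, antipodeHom]

theorem antipodeLin_s_pow (l : ℕ) (i : Fin 2) :
    antipodeLin l (s l ^ parity i) = s l ^ parity i := by
  have := antipodeLin_algebraMap l 1
  fin_cases i
  · simpa [parity] using this
  · simp [parity, antipodeLin_s]

theorem rTensor_mul {l : ℕ} (u v : Usigma l ⊗[ℂ] Usigma l) {c d : ℂ}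
    (hu : LinearMap.mul' ℂ _ ((antipodeLin l).rTensor _ u) = algebraMap ℂ _ c)
    (hv : LinearMap.mul' ℂ _ ((antipodeLin l).rTensor _ v) = algebraMap ℂ _ d) :
    LinearMap.mul' ℂ _ ((antipodeLin l).rTensor _ (u * v)) = algebraMap ℂ _ (c * d) := by
  have key : ∀ (x y : Usigma l), LinearMap.mul' ℂ _ ((antipodeLin l).rTensor _ (u * x ⊗ₜ[ℂ] y))
      = c • LinearMap.mul' ℂ _ ((antipodeLin l).rTensor _ (x ⊗ₜ[ℂ] y)) := by
    intro x y
    have : LinearMap.mul' ℂ _ ((antipodeLin l).rTensor _ (u * x ⊗ₜ[ℂ] y))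
        = antipodeLin l x * LinearMap.mul' ℂ _ ((antipodeLin l).rTensor _ u) * y := by
      clear hu
      induction u with
      | zero => simp
      | tmul a b => simp [antipodeLin_mul, mul_assoc]
      | add a b ha hb => simp only [mul_add, add_mul, map_add, ha, hb]
    rw [this, hu, ← Algebra.commutes, mul_assoc, ← Algebra.smul_def]
    simp
  have : ∀ w, LinearMap.mul' ℂ _ ((antipodeLin l).rTensor _ (u * w))
      = c • LinearMap.mul' ℂ _ ((antipodeLin l).rTensor _ w) := by
    intro w
    induction w with
    | zero => simp
    | tmul a b => exact key a b
    | add a b ha hb => simp only [mul_add, map_add, smul_add, ha, hb]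
  rw [this, hv, Algebra.smul_def, map_mul]

theorem lTensor_mul {l : ℕ} (u v : Usigma l ⊗[ℂ] Usigma l) {c d : ℂ}
    (hu : LinearMap.mul' ℂ _ ((antipodeLin l).lTensor _ u) = algebraMap ℂ _ c)
    (hv : LinearMap.mul' ℂ _ ((antipodeLin l).lTensor _ v) = algebraMap ℂ _ d) :
    LinearMap.mul' ℂ _ ((antipodeLin l).lTensor _ (u * v)) = algebraMap ℂ _ (c * d) := by
  have key : ∀ (x y : Usigma l), LinearMap.mul' ℂ _ ((antipodeLin l).lTensor _ (x ⊗ₜ[ℂ] y * v))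
      = d • LinearMap.mul' ℂ _ ((antipodeLin l).lTensor _ (x ⊗ₜ[ℂ] y)) := by
    intro x y
    have : LinearMap.mul' ℂ _ ((antipodeLin l).lTensor _ (x ⊗ₜ[ℂ] y * v))
        = x * LinearMap.mul' ℂ _ ((antipodeLin l).lTensor _ v) * antipodeLin l y := by
      clear hv
      induction v with
      | zero => simp
      | tmul a b => simp [antipodeLin_mul, mul_assoc]
      | add a b ha hb => simp only [mul_add, add_mul, map_add, ha, hb]
    rw [this, hv, ← Algebra.commutes, mul_assoc, ← Algebra.smul_def]
    simp
  have : ∀ w, LinearMap.mul' ℂ _ ((antipodeLin l).lTensor _ (w * v))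
      = d • LinearMap.mul' ℂ _ ((antipodeLin l).lTensor _ w) := by
    intro w
    induction w with
    | zero => simp
    | tmul a b => exact key a b
    | add a b ha hb => simp only [add_mul, map_add, smul_add, ha, hb]
  rw [this, hu, Algebra.smul_def, map_mul, Algebra.commutes]

theorem s_pow_sq (l : ℕ) (n : ℕ) : s l ^ n * s l ^ n = 1 := by
  rw [← (Commute.refl (s l)).mul_pow, ← pow_two, (relations l).s_sq, one_pow]

theorem antipode_left (l : ℕ) [Fact (Odd l)] (x : Usigma l) :
    LinearMap.mul' ℂ _ ((antipodeLin l).rTensor _ (Coalgebra.comul (R := ℂ) x))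
      = algebraMap ℂ _ (Coalgebra.counit (R := ℂ) x) := by
  have h := relations l
  have h1 : antipodeLin l 1 = 1 := by simpa using antipodeLin_algebraMap l 1
  induction x using Usigma.induction with
  | halg c => simp [antipodeLin_algebraMap, Algebra.TensorProduct.algebraMap_apply]
  | hadd x y hx hy => simp only [map_add, hx, hy]
  | hmul x y hx hy => rw [Bialgebra.comul_mul, Bialgebra.counit_mul]; exact rTensor_mul _ _ hx hy
  | hk i => simp [comul_k, counit_k, antipodeLin_k, h.kInv_mul_k]
  | hk' i => simp [comul_kInv, counit_kInv, antipodeLin_kInv, h.k_mul_kInv]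
  | he i =>
    simp [comul_e, counit_e, antipodeLin_e, antipodeLin_mul, antipodeLin_kInv, antipodeLin_s_pow]
  | hf i =>
    simp [comul_f, counit_f, antipodeLin_f, antipodeLin_s_pow, mul_assoc, h.kInv_mul_k]
  | hs => simp [comul_s, counit_s, antipodeLin_s, ← pow_two, h.s_sq]

theorem antipode_right (l : ℕ) [Fact (Odd l)] (x : Usigma l) :
    LinearMap.mul' ℂ _ ((antipodeLin l).lTensor _ (Coalgebra.comul (R := ℂ) x))
      = algebraMap ℂ _ (Coalgebra.counit (R := ℂ) x) := by
  have h := relations l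
  have h1 : antipodeLin l 1 = 1 := by simpa using antipodeLin_algebraMap l 1
  induction x using Usigma.induction with
  | halg c => simp [h1, Algebra.TensorProduct.algebraMap_apply]
  | hadd x y hx hy => simp only [map_add, hx, hy]
  | hmul x y hx hy => rw [Bialgebra.comul_mul, Bialgebra.counit_mul]; exact lTensor_mul _ _ hx hy
  | hk i => simp [comul_k, counit_k, antipodeLin_k, h.k_mul_kInv]
  | hk' i => simp [comul_kInv, counit_kInv, antipodeLin_kInv, h.kInv_mul_k]
  | he i =>
    have : kInv l i * s l ^ parity i * (s l ^ parity i * k l i * e l i) = e l i := by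
      calc _ = kInv l i * (s l ^ parity i * s l ^ parity i) * k l i * e l i := by
            simp only [mul_assoc]
        _ = _ := by rw [s_pow_sq, mul_one, h.kInv_mul_k, one_mul]
    simp [comul_e, counit_e, antipodeLin_e, h1, this]
  | hf i =>
    have : s l ^ parity i * (s l ^ parity i * f l i * kInv l i) = f l i * kInv l i := by
      simp only [← mul_assoc]; rw [s_pow_sq, one_mul]
    simp [comul_f, counit_f, antipodeLin_f, antipodeLin_k, this]
  | hs => simp [comul_s, counit_s, antipodeLin_s, ← pow_two, h.s_sq]

noncomputable instance (l : ℕ) [Fact (Odd l)] : HopfAlgebra ℂ (Usigma l) where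
  antipode := antipodeLin l
  mul_antipode_rTensor_comul := by ext x; exact antipode_left l x
  mul_antipode_lTensor_comul := by ext x; exact antipode_right l x

theorem antipode_eq (l : ℕ) [Fact (Odd l)] :
    HopfAlgebra.antipode ℂ (A := Usigma l) = antipodeLin l := rfl

theorem k_pow_comm (l : ℕ) (i : Fin 2) (x : Usigma l) : k l i ^ l * x = x * k l i ^ l := by
  have h := relations l
  have hz : (xi l) ^ l = 1 ∨ l = 0 := by
    rcases Nat.eq_zero_or_pos l with h0 | h0
    · exact Or.inr h0
    · exact Or.inl (Complex.isPrimitiveRoot_exp l h0.ne').pow_eq_one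
  have hpow : ∀ a : ℤ, (xi l ^ a) ^ l = 1 := by
    intro a
    rcases hz with hz | hz
    · rw [← zpow_natCast, ← zpow_mul, mul_comm, zpow_mul, zpow_natCast, hz, one_zpow]
    · rw [hz, pow_zero]
  induction x using Usigma.induction with
  | halg c => exact (Algebra.commutes c _).symm
  | hadd x y hx hy => rw [mul_add, add_mul, hx, hy]
  | hmul x y hx hy => rw [← mul_assoc, hx, mul_assoc, hy, mul_assoc]
  | hk j => exact (Commute.pow_left (h.kk i j) l)
  | hk' j => exact (Commute.pow_left (h.kk' i j) l)
  | he j => rw [pow_mul_of_qcomm (h.ke i j), hpow, one_smul]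
  | hf j => rw [pow_mul_of_qcomm (h.kf i j), hpow, one_smul]
  | hs => exact (Commute.pow_left (h.s_k i).symm l)

end Usigma

/-! ## The small quantum group -/

/-- The ideal of `U^σ` generated by `k_1^ℓ - 1` and `k_2^ℓ - 1`. These elements are central, so
the left ideal they generate is two-sided. -/
noncomputable def kIdeal (l : ℕ) : Ideal (Usigma l) :=
  Ideal.span (Set.range fun i : Fin 2 => Usigma.k l i ^ l - 1)

theorem kIdeal_central (l : ℕ) (i : Fin 2) (x : Usigma l) :
    (Usigma.k l i ^ l - 1) * x = x * (Usigma.k l i ^ l - 1) := by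
  rw [sub_mul, mul_sub, Usigma.k_pow_comm, one_mul, mul_one]

theorem mem_kIdeal (l : ℕ) (i : Fin 2) (x : Usigma l) :
    x * (Usigma.k l i ^ l - 1) ∈ kIdeal l :=
  Ideal.mul_mem_left _ _ (Ideal.subset_span ⟨i, rfl⟩)

theorem kIdeal_induction {l : ℕ} {P : (x : Usigma l) → x ∈ kIdeal l → Prop}
    (h0 : P 0 (zero_mem _)) (hadd : ∀ x y hx hy, P x hx → P y hy → P (x + y) (add_mem hx hy))
    (hgen : ∀ x i, P (x * (Usigma.k l i ^ l - 1)) (mem_kIdeal l i x))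
    {x : Usigma l} (hx : x ∈ kIdeal l) : P x hx := by
  refine Submodule.closure_induction (p := P) h0 hadd ?_ hx
  rintro r _ ⟨i, rfl⟩
  exact hgen r i

instance (l : ℕ) : (kIdeal l).IsTwoSided where
  mul_mem_of_left {a} b ha := by
    induction ha using kIdeal_induction with
    | h0 => simp
    | hadd x y _ _ hx hy => rw [add_mul]; exact add_mem hx hy
    | hgen x i => rw [mul_assoc, kIdeal_central, ← mul_assoc]; exact mem_kIdeal l i _

instance (l : ℕ) [Fact (Odd l)] : (kIdeal l).IsHopfIdeal ℂ where
  counit_eq_zero x hx := by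
    replace hx : x ∈ kIdeal l := hx
    induction hx using kIdeal_induction with
    | h0 => simp
    | hadd x y _ _ hx hy => rw [map_add, hx, hy, add_zero]
    | hgen x i => simp [Bialgebra.counit_mul, Usigma.counit_k]
  map_mkQ_comul_eq_zero x hx := by
    replace hx : x ∈ kIdeal l := hx
    change Algebra.TensorProduct.map (Ideal.Quotient.mkₐ ℂ (kIdeal l))
      (Ideal.Quotient.mkₐ ℂ (kIdeal l)) (Coalgebra.comul (R := ℂ) x) = 0
    induction hx using kIdeal_induction with
    | h0 => simp
    | hadd x y _ _ hx hy => rw [map_add, map_add, hx, hy, add_zero]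
    | hgen x i =>
      have hk : Ideal.Quotient.mk (kIdeal l) (Usigma.k l i) ^ l = 1 := by
        rw [← map_pow, ← map_one (Ideal.Quotient.mk (kIdeal l)), Ideal.Quotient.eq]
        simpa using mem_kIdeal l i 1
      rw [Bialgebra.comul_mul, map_mul, map_sub, Bialgebra.comul_pow, Usigma.comul_k]
      simp [Algebra.TensorProduct.tmul_pow, hk, Algebra.TensorProduct.one_def]
  antipode_mem x hx := by
    rw [Usigma.antipode_eq]
    induction hx using kIdeal_induction with
    | h0 => simp
    | hadd x y _ _ hx hy => rw [map_add]; exact add_mem hx hy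
    | hgen x i =>
      have h1 : ∀ n, Usigma.antipodeLin l (Usigma.k l i ^ n) = Usigma.kInv l i ^ n := by
        intro n
        induction n with
        | zero => simpa using Usigma.antipodeLin_algebraMap l 1
        | succ n ih => rw [pow_succ, Usigma.antipodeLin_mul, ih, Usigma.antipodeLin_k, ← pow_succ']
      have h2 : Usigma.kInv l i ^ l - 1 = -(Usigma.kInv l i ^ l) * (Usigma.k l i ^ l - 1) := by
        have hc : Commute (Usigma.kInv l i) (Usigma.k l i) :=
          ((Usigma.relations l).kInv_mul_k i).trans ((Usigma.relations l).k_mul_kInv i).symm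
        rw [mul_sub, neg_mul, ← hc.mul_pow, (Usigma.relations l).kInv_mul_k]
        simp only [one_pow, mul_one]
        abel
      rw [Usigma.antipodeLin_mul, map_sub, h1, show Usigma.antipodeLin l 1 = 1 by
        simpa using Usigma.antipodeLin_algebraMap l 1, h2, mul_assoc, kIdeal_central, ← mul_assoc]
      exact mem_kIdeal l i _

/-- The small (restricted) quantum group `U_0`: the quotient of `U^σ` by `k_1^ℓ = k_2^ℓ = 1`.
It carries the quotient Hopf algebra structure. -/
abbrev SmallQuantumGroup (l : ℕ) : Type := Usigma l ⧸ kIdeal l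

/-! ## Integrals and unimodularity -/

section Integral

variable (R H : Type*) [CommRing R] [Ring H] [HopfAlgebra R H]

/-- The space of left integrals in `H`: the `t` with `x t = ε(x) t` for all `x`. -/
def leftIntegrals : Submodule R H where
  carrier := {t | ∀ x : H, x * t = Coalgebra.counit (R := R) x • t}
  add_mem' ha hb x := by rw [mul_add, ha x, hb x, smul_add]
  zero_mem' x := by simp
  smul_mem' c t ht x := by rw [mul_smul_comm, ht x, smul_comm]

/-- The space of right integrals in `H`: the `t` with `t x = ε(x) t` for all `x`. -/
def rightIntegrals : Submodule R H where
  carrier := {t | ∀ x : H, t * x = Coalgebra.counit (R := R) x • t}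
  add_mem' ha hb x := by rw [add_mul, ha x, hb x, smul_add]
  zero_mem' x := by simp
  smul_mem' c t ht x := by rw [smul_mul_assoc, ht x, smul_comm]

/-- A Hopf algebra that is finite over the base ring is unimodular if it has a nonzero left
integral and its left integrals are the same as its right integrals. (Over a field, a nonzero left
integral exists in every finite-dimensional Hopf algebra.) -/
structure IsUnimodular : Prop where
  finite : Module.Finite R H
  exists_ne_zero : ∃ t ∈ leftIntegrals R H, t ≠ 0
  left_eq_right : leftIntegrals R H = rightIntegrals R H

end Integral

end SmallQuantumSl21

/-! The proof combines the general theory of integrals with the weights of the small quantum group.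

A finite-dimensional Hopf algebra `H` is a Hopf module over its dual: the dual acts by
`t · φ = t₍₁₎ φ(S(t₍₂₎))`, and left multiplication by `H` is the coaction. The coinvariants are the
left integrals, and the decomposition of Hopf modules shows that there is exactly one left integral
up to scalars (`exists_ne_zero_mem_leftIntegrals`, `exists_smul_eq_of_mem_leftIntegrals`). Right
multiplication on a nonzero left integral `t` is therefore given by a character `α`, and `H` is
unimodular if `α = ε` and the antipode is surjective (`isUnimodular_of_surjective_antipode`).

In the small quantum group a character vanishes on the `e_i` and `f_i`, which have nontrivial
weight, and then takes the value `1` on the `k_i`, because `ℓ` is odd (`Relations.character_eq`).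
It remains to exclude `α(σ) = -1`. In that case `t` anticommutes with `σ`, so it is odd, whereas it
commutes with `k₁ k₂²`. Conjugation by `k₁ k₂²` multiplies `e₂` by `ξ⁻¹`, `f₂` by `ξ`, and fixes all
other generators. By the triangular decomposition
(`Relations.triangularSpan_eq_top`) every element is a combination of monomials containing at most
two odd root vectors of each sign; the odd ones among them have degree `±1` under this conjugation,
hence no nonzero odd element is fixed by it (`Relations.eq_zero_of_commute_of_odd`).
The triangular decomposition also yields the finiteness of the dimension; linear independence of
the monomials is not needed. -/

namespace SmallQuantumSl21

/-! ### Integrals in finite-dimensional Hopf algebras -/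

section HopfIntegral

open Coalgebra HopfAlgebra Module TensorProduct

variable {K H : Type*} [Field K] [Ring H] [HopfAlgebra K H]

/-- The action `(ψ, m) ↦ m₍₁₎ ψ(m₍₂₎)` of the linear dual on a coalgebra. -/
noncomputable def dualAct : Dual K H →ₗ[K] H →ₗ[K] H :=
  LinearMap.mk₂ K (fun ψ m => TensorProduct.rid K H (ψ.lTensor H (comul m)))
    (by intros; simp [LinearMap.lTensor_add]) (by intros; simp [LinearMap.lTensor_smul])
    (by intros; simp) (by intros; simp)

/-- The convolution product on the linear dual. -/
noncomputable def dualConv : Dual K H →ₗ[K] Dual K H →ₗ[K] Dual K H :=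
  LinearMap.mk₂ K (fun ψ χ => LinearMap.mul' K K ∘ₗ TensorProduct.map ψ χ ∘ₗ comul)
    (by intros; ext; simp [TensorProduct.map_add_left])
    (by intros; ext; simp [TensorProduct.map_smul_left])
    (by intros; ext; simp [TensorProduct.map_add_right])
    (by intros; ext; simp [TensorProduct.map_smul_right])

theorem dualAct_eq_sum {ι : Type*} (ψ : Dual K H) {m : H} (r : Coalgebra.Repr K m ι) :
    dualAct ψ m = ∑ i ∈ r.index, ψ (r.right i) • r.left i := by
  simp [dualAct, ← r.eq]

theorem dualConv_eq_sum {ι : Type*} (ψ χ : Dual K H) {m : H} (r : Coalgebra.Repr K m ι) :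
    dualConv ψ χ m = ∑ i ∈ r.index, ψ (r.left i) * χ (r.right i) := by
  simp [dualConv, ← r.eq]

theorem dualAct_counit (m : H) : dualAct (counit : Dual K H) m = m := by
  simp [dualAct]

theorem dualAct_dualAct (ψ χ : Dual K H) (m : H) :
    dualAct ψ (dualAct χ m) = dualAct (dualConv ψ χ) m := by
  let F : H ⊗[K] (H ⊗[K] H) →ₗ[K] H :=
    (TensorProduct.rid K H).toLinearMap ∘ₗ
      (LinearMap.mul' K K ∘ₗ TensorProduct.map ψ χ).lTensor H
  have h := congrArg F (sum_tmul_tmul_eq (ℛ K m) (fun i => ℛ K ((ℛ K m).left i))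
    (fun i => ℛ K ((ℛ K m).right i)))
  simp only [map_sum, F, LinearMap.comp_apply, LinearMap.lTensor_tmul, TensorProduct.map_tmul,
    LinearMap.mul'_apply, LinearEquiv.coe_coe, TensorProduct.rid_tmul] at h
  rw [dualAct_eq_sum χ (ℛ K m), dualAct_eq_sum (dualConv ψ χ) (ℛ K m), map_sum]
  simp only [map_smul, dualAct_eq_sum ψ (ℛ K ((ℛ K m).left _)),
    dualConv_eq_sum ψ χ (ℛ K ((ℛ K m).right _)), Finset.sum_smul, Finset.smul_sum, smul_smul]
  rw [← h]
  exact Finset.sum_congr rfl fun i _ => Finset.sum_congr rfl fun j _ => by rw [mul_comm]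

/-- Left multiplication by `x` commutes with the action of `φ ∘ S` up to the coproduct of `x`:
`x (m · φ) = (x₍₁₎ m) · φ(- x₍₂₎)`, where `m · φ = m₍₁₎ φ(S(m₍₂₎))`. -/
theorem mul_dualAct {ι : Type*} (φ : Dual K H) (m : H) {x : H} (r : Coalgebra.Repr K x ι) :
    x * dualAct (φ ∘ₗ antipode K) m = ∑ i ∈ r.index,
      dualAct (φ ∘ₗ LinearMap.mulRight K (r.right i) ∘ₗ antipode K) (r.left i * m) := by
  let F (p q : H) : H ⊗[K] (H ⊗[K] H) →ₗ[K] H :=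
    (TensorProduct.rid K H).toLinearMap ∘ₗ TensorProduct.map (LinearMap.mulRight K p)
      (φ ∘ₗ LinearMap.mulLeft K (antipode K q) ∘ₗ LinearMap.mul' K H ∘ₗ
        (antipode K).rTensor H)
  have h (p q : H) : ∑ i ∈ r.index, ∑ j ∈ (ℛ K (r.left i)).index,
      φ (antipode K q * (antipode K ((ℛ K (r.left i)).right j) * r.right i)) •
        ((ℛ K (r.left i)).left j * p) = φ (antipode K q) • (x * p) := by
    have h := congrArg (F p q) (sum_tmul_tmul_eq r (fun i => ℛ K (r.left i))
      (fun i => ℛ K (r.right i)))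
    simp only [map_sum, F, LinearMap.comp_apply, LinearMap.rTensor_tmul, TensorProduct.map_tmul,
      LinearMap.mul'_apply, LinearEquiv.coe_coe, TensorProduct.rid_tmul,
      LinearMap.mulLeft_apply, LinearMap.mulRight_apply] at h
    rw [h]
    have hx := congrArg (TensorProduct.rid K H) (sum_tmul_counit_eq r)
    simp only [map_sum, TensorProduct.rid_tmul, one_smul] at hx
    calc _ = ∑ i ∈ r.index, φ (antipode K q * ∑ j ∈ (ℛ K (r.right i)).index,
          antipode K ((ℛ K (r.right i)).left j) * (ℛ K (r.right i)).right j) •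
            (r.left i * p) := by
          simp only [Finset.mul_sum, map_sum, Finset.sum_smul]
      _ = ∑ i ∈ r.index, φ (antipode K q) • ((counit (R := K) (r.right i) • r.left i) * p) := by
          refine Finset.sum_congr rfl fun i _ => ?_
          rw [sum_antipode_mul_eq_smul, mul_smul_comm, mul_one, map_smul, smul_mul_assoc,
            smul_smul, smul_eq_mul, mul_comm]
      _ = _ := by rw [← Finset.smul_sum, ← Finset.sum_mul, hx]
  have hr (i : ι) := dualAct_eq_sum (φ ∘ₗ LinearMap.mulRight K (r.right i) ∘ₗ antipode K)
    ((ℛ K (r.left i)).mul (ℛ K m))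
  simp only [hr]
  rw [dualAct_eq_sum _ (ℛ K m), Finset.mul_sum]
  simp only [LinearMap.comp_apply, LinearMap.mulRight_apply, mul_smul_comm, ← h]
  rw [Finset.sum_comm]
  refine Finset.sum_congr rfl fun i _ => ?_
  rw [Finset.sum_comm]
  refine (Finset.sum_product' _ _ _).symm.trans (Finset.sum_congr rfl fun p _ => ?_)
  simp [antipode_mul_antidistrib, mul_assoc]

/-- In a sum over dual bases, precomposition of the functionals with `A` can be traded for applying
`A` to the basis vectors. -/
theorem sum_coord_comp_eq {ι M : Type*} [Fintype ι] [AddCommGroup M] [Module K M]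
    (b : Basis ι K H) (G : Dual K H →ₗ[K] H →ₗ[K] M) (A : H →ₗ[K] H) :
    ∑ i, G (b.coord i ∘ₗ A) (b i) = ∑ i, G (b.coord i) (A (b i)) := by
  have h1 (i : ι) : G (b.coord i ∘ₗ A) (b i) =
      ∑ j, b.coord i (A (b j)) • G (b.coord j) (b i) := by
    conv_lhs => rw [← b.sum_dual_apply_smul_coord (b.coord i ∘ₗ A)]
    simp
  have h2 (i : ι) : G (b.coord i) (A (b i)) =
      ∑ j, b.coord j (A (b i)) • G (b.coord i) (b j) := by
    conv_lhs => rw [← b.sum_repr (A (b i))]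
    simp only [map_sum, map_smul, Basis.coord_apply]
  simp only [h1, h2]
  exact Finset.sum_comm

section Projection

variable {ι : Type*} [Fintype ι] (b : Basis ι K H)

/-- The trace-like projection `m ↦ ∑ (bᵢ m)₍₁₎ bⁱ(S²((bᵢ m)₍₂₎))` of a finite-dimensional Hopf
algebra onto its left integrals. It is the projection `m ↦ m₍₀₎ S(m₍₁₎)` onto the coinvariants for
the Hopf module structure of `H` over the dual Hopf algebra. -/
noncomputable def integralProj (m : H) : H :=
  ∑ i, dualAct (b.coord i ∘ₗ antipode K ∘ₗ antipode K) (b i * m)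

theorem integralProj_mem (m : H) : integralProj b m ∈ leftIntegrals K H := by
  intro x
  rw [integralProj, Finset.mul_sum]
  have hx := sum_mul_antipode_eq_smul (ℛ K x)
  let G (a : H) : Dual K H →ₗ[K] H →ₗ[K] H :=
    (dualAct.compl₂ (LinearMap.mulLeft K a ∘ₗ LinearMap.mulRight K m)).comp
      (LinearMap.lcomp K K (antipode K ∘ₗ antipode K))
  calc ∑ i, x * dualAct (b.coord i ∘ₗ antipode K ∘ₗ antipode K) (b i * m)
      = ∑ i, ∑ r ∈ (ℛ K x).index, G ((ℛ K x).left r)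
          (b.coord i ∘ₗ LinearMap.mulLeft K (antipode K ((ℛ K x).right r))) (b i) := by
        refine Finset.sum_congr rfl fun i _ => ?_
        rw [← LinearMap.comp_assoc, mul_dualAct _ _ (ℛ K x)]
        refine Finset.sum_congr rfl fun r _ => ?_
        simp only [G, LinearMap.comp_apply, LinearMap.compl₂_apply, LinearMap.mulLeft_apply,
          LinearMap.mulRight_apply, LinearMap.lcomp_apply']
        congr 2
        ext y
        simp [antipode_mul_antidistrib]
    _ = ∑ i, ∑ r ∈ (ℛ K x).index, G ((ℛ K x).left r) (b.coord i)
          (antipode K ((ℛ K x).right r) * b i) := by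
        rw [Finset.sum_comm]
        simp only [sum_coord_comp_eq, LinearMap.mulLeft_apply]
        rw [Finset.sum_comm]
    _ = _ := by
        rw [Finset.smul_sum]
        refine Finset.sum_congr rfl fun i _ => ?_
        simp only [G, LinearMap.comp_apply, LinearMap.compl₂_apply, LinearMap.mulLeft_apply,
          LinearMap.mulRight_apply, LinearMap.lcomp_apply', ← map_smul, ← map_sum]
        congr 1
        simp only [← mul_assoc, ← Finset.sum_mul, hx, smul_mul_assoc, one_mul]

/-- Multiplication of basis vectors is dual to the coproduct, so the sum collapses to
`S(y₍₁₎ S(y₍₂₎)) = ε(y)`. -/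
theorem sum_dualConv_coord_smul (y : H) :
    ∑ j, ∑ i, dualConv (b.coord j ∘ₗ antipode K) (b.coord i ∘ₗ antipode K ∘ₗ antipode K) y •
      (b i * b j) = counit (R := K) y • (1 : H) := by
  have hS := congrArg (antipode K) (sum_mul_antipode_eq_smul (ℛ K y))
  simp only [map_sum, antipode_mul_antidistrib, map_smul, antipode_one] at hS
  rw [← hS]
  simp only [dualConv_eq_sum _ _ (ℛ K y), Finset.sum_smul, LinearMap.comp_apply]
  calc _ = ∑ r ∈ (ℛ K y).index, (∑ i, b.coord i (antipode K (antipode K ((ℛ K y).right r))) • b i) *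
        (∑ j, b.coord j (antipode K ((ℛ K y).left r)) • b j) := by
        simp only [Finset.sum_mul_sum, smul_mul_smul_comm]
        rw [Finset.sum_congr rfl fun j _ => Finset.sum_comm, Finset.sum_comm]
        refine Finset.sum_congr rfl fun r _ => ?_
        rw [Finset.sum_comm]
        simp only [mul_comm]
    _ = _ := by simp only [Basis.coord_apply, b.sum_repr]

/-- An element is recovered from the integrals `integralProj b (b j * m)`; this is the
decomposition of a Hopf module into its coinvariants. -/
theorem sum_dualAct_integralProj (m : H) :
    ∑ j, dualAct (b.coord j ∘ₗ antipode K) (integralProj b (b j * m)) = m := by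
  have key (ψ : ι → ι → Dual K H) (j i : ι) : dualAct (ψ j i) (b i * (b j * m)) =
      ∑ k, dualAct (b.coord k) ((ψ j i (b k) • (b i * b j)) * m) := by
    conv_lhs => rw [← b.sum_dual_apply_smul_coord (ψ j i)]
    simp only [map_sum, map_smul, LinearMap.sum_apply, LinearMap.smul_apply, smul_mul_assoc,
      mul_assoc]
  simp only [integralProj, map_sum, dualAct_dualAct]
  simp only [key (fun j i => dualConv (b.coord j ∘ₗ antipode K)
    (b.coord i ∘ₗ antipode K ∘ₗ antipode K))]
  calc _ = ∑ k, dualAct (b.coord k) ((∑ j, ∑ i, dualConv (b.coord j ∘ₗ antipode K)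
        (b.coord i ∘ₗ antipode K ∘ₗ antipode K) (b k) • (b i * b j)) * m) := by
        simp only [Finset.sum_mul, map_sum]
        rw [Finset.sum_congr rfl fun j _ => Finset.sum_comm, Finset.sum_comm]
    _ = dualAct (∑ k, counit (R := K) (b k) • b.coord k) m := by
        simp only [sum_dualConv_coord_smul, smul_mul_assoc, one_mul, map_sum, map_smul,
          LinearMap.sum_apply, LinearMap.smul_apply]
    _ = m := by rw [b.sum_dual_apply_smul_coord counit, dualAct_counit]

/-- For an integral `t`, the identity `mul_dualAct` reduces to `x (t · φ) = t · φ(- x)`. -/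
theorem mul_dualAct_of_mem {t : H} (ht : t ∈ leftIntegrals K H) (φ : Dual K H) (x : H) :
    x * dualAct (φ ∘ₗ antipode K) t =
      dualAct (φ ∘ₗ LinearMap.mulRight K x ∘ₗ antipode K) t := by
  rw [mul_dualAct _ _ (ℛ K x)]
  simp only [show ∀ y, y * t = counit (R := K) y • t from ht, map_smul]
  have hx := sum_counit_smul (ℛ K x)
  conv_rhs => rw [← hx]
  let G : H →ₗ[K] H := ((dualAct (K := K)).flip t) ∘ₗ (LinearMap.lcomp K K (antipode K)) ∘ₗ
    (LinearMap.compRight K φ) ∘ₗ (LinearMap.mul K H).flip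
  change ∑ i ∈ _, counit (R := K) _ • G _ = G _
  rw [map_sum]
  simp

/-- The projection sends `t · φ` to `φ(1) t`, because `t · φ` corresponds to `t ⊗ φ` in the
decomposition of the Hopf module `H` as integrals tensored with the dual. -/
theorem integralProj_dualAct {t : H} (ht : t ∈ leftIntegrals K H) (φ : Dual K H) :
    integralProj b (dualAct (φ ∘ₗ antipode K) t) = φ 1 • t := by
  simp only [integralProj, mul_dualAct_of_mem ht, dualAct_dualAct]
  have : ∑ i, dualConv (b.coord i ∘ₗ antipode K ∘ₗ antipode K)
      (φ ∘ₗ LinearMap.mulRight K (b i) ∘ₗ antipode K) = φ 1 • (counit : Dual K H) := by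
    ext y
    have hS := congrArg (φ ∘ₗ antipode K) (sum_antipode_mul_eq_smul (ℛ K y))
    simp only [LinearMap.comp_apply, map_sum, antipode_mul_antidistrib, map_smul,
      antipode_one] at hS
    simp only [LinearMap.sum_apply, dualConv_eq_sum _ _ (ℛ K y), LinearMap.comp_apply,
      LinearMap.mulRight_apply, LinearMap.smul_apply, smul_eq_mul] at hS ⊢
    rw [mul_comm, ← hS, Finset.sum_comm]
    refine Finset.sum_congr rfl fun r _ => ?_
    conv_rhs => rw [← b.sum_repr (antipode K (antipode K ((ℛ K y).left r)))]
    simp only [Finset.mul_sum, mul_smul_comm, map_sum, map_smul, smul_eq_mul, Basis.coord_apply]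
  rw [← LinearMap.sum_apply, ← map_sum, this]
  simp [dualAct_counit]

end Projection

variable [FiniteDimensional K H]

/-- Every finite-dimensional Hopf algebra has a nonzero left integral. -/
theorem exists_ne_zero_mem_leftIntegrals : ∃ t ∈ leftIntegrals K H, t ≠ 0 := by
  have : Nontrivial H := Bialgebra.nontrivial (R := K)
  by_contra! h
  let b := Module.finBasis K H
  -- The unit is recovered from integrals, so they cannot all vanish.
  have h1 := sum_dualAct_integralProj b (1 : H)
  simp only [fun m => h _ (integralProj_mem b m), map_zero, Finset.sum_const_zero] at h1
  exact zero_ne_one h1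

/-- Left integrals are unique up to scalars. For `t ≠ 0` the map `φ ↦ t · φ` from the dual is
injective, hence bijective; writing `u = t · φ` and projecting gives `u = φ(1) t`. -/
theorem exists_smul_eq_of_mem_leftIntegrals {t u : H} (ht : t ∈ leftIntegrals K H) (ht0 : t ≠ 0)
    (hu : u ∈ leftIntegrals K H) : ∃ c : K, c • t = u := by
  let b := Module.finBasis K H
  let T : Dual K H →ₗ[K] H := (dualAct.flip t) ∘ₗ LinearMap.lcomp K K (antipode K)
  have hT (φ : Dual K H) : T φ = dualAct (φ ∘ₗ antipode K) t := rfl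
  have hinj : Function.Injective T := by
    rw [injective_iff_map_eq_zero]
    intro φ hφ
    ext x
    have h1 := integralProj_dualAct b ht (φ ∘ₗ LinearMap.mulRight K x)
    rw [LinearMap.comp_assoc, ← mul_dualAct_of_mem ht, ← hT, hφ] at h1
    simpa [integralProj, ht0] using h1.symm
  have hsurj : Function.Surjective T :=
    (LinearMap.injective_iff_surjective_of_finrank_eq_finrank
      (Subspace.dual_finrank_eq (K := K) (V := H))).mp hinj
  obtain ⟨φ, hφ⟩ := hsurj u
  refine ⟨φ 1, ?_⟩
  have h1 := integralProj_dualAct b hu (counit : Dual K H)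
  rw [counit_comp_antipode, dualAct_counit, Bialgebra.counit_one, one_smul] at h1
  rw [← integralProj_dualAct b ht, ← hT, hφ, h1]

/-- The distinguished character of a finite-dimensional Hopf algebra: a left integral `t` satisfies
`t x = α(x) t`. -/
theorem exists_algHom_mul_eq {t : H} (ht : t ∈ leftIntegrals K H) (ht0 : t ≠ 0) :
    ∃ α : H →ₐ[K] K, ∀ x, t * x = α x • t := by
  have h (x : H) : ∃ c : K, c • t = t * x :=
    exists_smul_eq_of_mem_leftIntegrals ht ht0 fun y => by
      rw [← mul_assoc, ht y, smul_mul_assoc]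
  choose α hα using h
  have inj {c d : K} (h : c • t = d • t) : c = d := smul_left_injective K ht0 h
  refine ⟨AlgHom.ofLinearMap ⟨⟨α, fun x y => inj ?_⟩, fun c x => inj ?_⟩ (inj ?_)
    fun x y => inj ?_, fun x => (hα x).symm⟩
  · rw [hα, mul_add, add_smul, hα, hα]
  · rw [hα, mul_smul_comm, ← hα, smul_smul]; rfl
  · simpa using hα 1
  · simp only [LinearMap.coe_mk, AddHom.coe_mk]
    rw [hα, ← mul_assoc, ← hα x, smul_mul_assoc, ← hα y, smul_smul]

/-- A finite-dimensional Hopf algebra with surjective antipode is unimodular as soon as its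
distinguished character is the counit. -/
theorem isUnimodular_of_surjective_antipode (hS : Function.Surjective (antipode K (A := H)))
    (h : ∀ t ∈ leftIntegrals K H, ∀ α : H →ₐ[K] K, t ≠ 0 → (∀ x, t * x = α x • t) →
      ∀ x, α x = counit x) : IsUnimodular K H := by
  have hS' : Function.Injective (antipode K (A := H)) :=
    LinearMap.injective_iff_surjective.mpr hS
  have hLR : leftIntegrals K H ≤ rightIntegrals K H := by
    intro t ht x
    by_cases ht0 : t = 0
    · simp [ht0]
    · obtain ⟨α, hα⟩ := exists_algHom_mul_eq ht ht0
      rw [hα, h t ht α ht0 hα]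
  -- The antipode maps right integrals to left integrals.
  have hRL {t : H} (ht : t ∈ rightIntegrals K H) : antipode K t ∈ leftIntegrals K H := by
    intro x
    obtain ⟨y, rfl⟩ := hS x
    rw [← antipode_mul_antidistrib, ht y, map_smul, counit_antipode]
  refine ⟨inferInstance, exists_ne_zero_mem_leftIntegrals, le_antisymm hLR fun u hu => ?_⟩
  obtain ⟨t, ht, ht0⟩ := exists_ne_zero_mem_leftIntegrals (K := K) (H := H)
  obtain ⟨c, hc⟩ := exists_smul_eq_of_mem_leftIntegrals (hRL (hLR ht))
    ((map_ne_zero_iff _ hS').mpr ht0) (hRL hu)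
  rw [← map_smul] at hc
  rw [← hS' hc]
  exact Submodule.smul_mem _ _ ht

end HopfIntegral

/-! ### Triangular decomposition -/

section LeftStable

variable {A : Type*} [Ring A] [Algebra ℂ A]

/-- The subalgebra of those `a` with `a X ⊆ X`. -/
def leftStabilizer (X : Submodule ℂ A) : Subalgebra ℂ A where
  carrier := {a | ∀ x ∈ X, a * x ∈ X}
  mul_mem' ha hb x hx := by rw [mul_assoc]; exact ha _ (hb x hx)
  add_mem' ha hb x hx := by rw [add_mul]; exact add_mem (ha x hx) (hb x hx)
  algebraMap_mem' c x hx := by rw [← Algebra.smul_def]; exact X.smul_mem c hx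

theorem mem_leftStabilizer_span {S : Set A} {a : A}
    (h : ∀ x ∈ S, a * x ∈ Submodule.span ℂ S) : a ∈ leftStabilizer (Submodule.span ℂ S) := by
  intro x hx
  exact (Submodule.span_le (p := (Submodule.span ℂ S).comap (LinearMap.mulLeft ℂ a))).mpr h hx

theorem adjoin_le_of_leftStabilizer {X : Submodule ℂ A} {S : Set A} (h1 : 1 ∈ X)
    (hS : S ⊆ leftStabilizer X) : Subalgebra.toSubmodule (Algebra.adjoin ℂ S) ≤ X := by
  intro a ha
  simpa using Algebra.adjoin_le hS ha 1 h1

end LeftStable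

section FiniteRange

variable {A : Type*} [Ring A]

theorem finite_range_pow_of_pow_eq_zero {z : A} {n : ℕ} (h : z ^ n = 0) :
    (Set.range fun m : ℕ => z ^ m).Finite := by
  refine ((Set.finite_Iio n).image fun m => z ^ m).union (Set.finite_singleton 0) |>.subset ?_
  rintro _ ⟨m, rfl⟩
  rcases lt_or_ge m n with hm | hm
  · exact Or.inl ⟨m, hm, rfl⟩
  · exact Or.inr (pow_eq_zero_of_le hm h)

theorem finite_range_pow_of_pow_eq_one {z : A} {n : ℕ} (hn : 0 < n) (h : z ^ n = 1) :
    (Set.range fun m : ℕ => z ^ m).Finite := by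
  refine ((Set.finite_Iio n).image fun m => z ^ m).subset ?_
  rintro _ ⟨m, rfl⟩
  exact ⟨m % n, Nat.mod_lt _ hn, (pow_eq_pow_mod m h).symm⟩

theorem finite_range_pow_mul_pow_mul_pow {u v w : A} (hu : (Set.range fun m : ℕ => u ^ m).Finite)
    (hv : (Set.range fun m : ℕ => v ^ m).Finite) (hw : (Set.range fun m : ℕ => w ^ m).Finite) :
    (Set.range fun p : ℕ × ℕ × ℕ => u ^ p.1 * v ^ p.2.1 * w ^ p.2.2).Finite := by
  refine ((hu.mul hv).mul hw).subset ?_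
  rintro _ ⟨p, rfl⟩
  exact Set.mul_mem_mul (Set.mul_mem_mul ⟨_, rfl⟩ ⟨_, rfl⟩) ⟨_, rfl⟩

end FiniteRange

section HalfSpan

variable {A : Type*} [Ring A] [Algebra ℂ A] {q : ℂ} {x y : A}

/-- The `q`-commutator `x y - q y x`; applied to the simple root vectors it is the root vector of
the non-simple positive (or negative) root. -/
def qCommutator (q : ℂ) (x y : A) : A := x * y - q • (y * x)

theorem mul_qCommutator (hq : q ≠ 0)
    (hs : x ^ 2 * y - (q + q⁻¹) • (x * y * x) + y * x ^ 2 = 0) :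
    x * qCommutator q x y = q⁻¹ • (qCommutator q x y * x) := by
  rw [← sub_eq_zero, ← hs]
  simp only [qCommutator, pow_two, mul_sub, sub_mul, mul_smul_comm, smul_mul_assoc, smul_sub,
    smul_smul, inv_mul_cancel₀ hq, mul_assoc]
  module

theorem qCommutator_mul (hy : y ^ 2 = 0) :
    qCommutator q x y * y = (-q) • (y * qCommutator q x y) := by
  rw [pow_two] at hy
  simp only [qCommutator, sub_mul, mul_sub, mul_assoc, hy, smul_mul_assoc, mul_smul_comm,
    ← mul_assoc y y]
  simp

/-- The non-simple root vector is odd and squares to zero; this needs `q² ≠ -1`. -/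
theorem qCommutator_sq (hq : q ≠ 0) (hq2 : q ^ 2 ≠ -1) (hy : y ^ 2 = 0)
    (hs : x ^ 2 * y - (q + q⁻¹) • (x * y * x) + y * x ^ 2 = 0) :
    qCommutator q x y ^ 2 = 0 := by
  have h1 := mul_qCommutator hq hs
  have h2 := qCommutator_mul (q := q) (x := x) hy
  have hw : qCommutator q x y = x * y - q • (y * x) := rfl
  generalize qCommutator q x y = w at *
  have h3 : y * w = (-q⁻¹) • (w * y) := by
    rw [h2, smul_smul]; simp [hq]
  -- Expanding one factor of `w²` and moving the other one to the left gives back `w²`, scaled.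
  have h4 : w ^ 2 = -(q⁻¹ * q⁻¹) • w ^ 2 := by
    conv_lhs => rw [pow_two]; enter [1]; rw [hw]
    rw [sub_mul, smul_mul_assoc, mul_assoc, mul_assoc, h1, h3]
    simp only [mul_smul_comm, ← mul_assoc, h1, h3, smul_mul_assoc, smul_smul]
    conv_rhs => rw [pow_two]; enter [2, 2]; rw [hw]
    simp only [mul_sub, mul_smul_comm, smul_sub, smul_smul, ← mul_assoc]
    match_scalars <;> field_simp
  have h5 : (1 + q⁻¹ * q⁻¹) • w ^ 2 = 0 := by
    rw [add_smul, one_smul]; nth_rw 1 [h4]; module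
  refine (smul_eq_zero.mp h5).resolve_left fun h => hq2 ?_
  field_simp at h
  linear_combination h

/-- The ordered monomials `y^c [x, y]_q^b x^a`. -/
def halfMonomial (q : ℂ) (x y : A) (p : ℕ × ℕ × ℕ) : A :=
  y ^ p.1 * qCommutator q x y ^ p.2.1 * x ^ p.2.2

/-- The span of the ordered monomials in the root vectors of one half of the quantum group. -/
def halfSpan (q : ℂ) (x y : A) : Submodule ℂ A := Submodule.span ℂ (Set.range (halfMonomial q x y))

theorem halfMonomial_mem (p : ℕ × ℕ × ℕ) : halfMonomial q x y p ∈ halfSpan q x y :=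
  Submodule.subset_span ⟨p, rfl⟩

theorem one_mem_halfSpan : 1 ∈ halfSpan q x y := by
  simpa [halfMonomial] using halfMonomial_mem (q := q) (x := x) (y := y) (0, 0, 0)

theorem right_mem_leftStabilizer_halfSpan : y ∈ leftStabilizer (halfSpan q x y) := by
  refine mem_leftStabilizer_span ?_
  rintro _ ⟨⟨c, b, a⟩, rfl⟩
  have : y * halfMonomial q x y (c, b, a) = halfMonomial q x y (c + 1, b, a) := by
    simp [halfMonomial, pow_succ', mul_assoc]
  rw [this]
  exact halfMonomial_mem _

/-- The span of the ordered monomials is stable under left multiplication by the even root vector,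
which moves to the right past the other root vectors at the cost of a `q`-commutator. -/
theorem left_mem_leftStabilizer_halfSpan (hq : q ≠ 0) (hy : y ^ 2 = 0)
    (hs : x ^ 2 * y - (q + q⁻¹) • (x * y * x) + y * x ^ 2 = 0) :
    x ∈ leftStabilizer (halfSpan q x y) := by
  refine mem_leftStabilizer_span ?_
  rintro _ ⟨⟨c, b, a⟩, rfl⟩
  have hw (b : ℕ) := mul_pow_of_qcomm (mul_qCommutator hq hs) b
  have h0 : x * (qCommutator q x y ^ b * x ^ a) =
      q⁻¹ ^ b • halfMonomial q x y (0, b, a + 1) := by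
    rw [← mul_assoc, hw, smul_mul_assoc, mul_assoc, ← pow_succ']
    simp [halfMonomial]
  match c with
  | 0 =>
    have : x * halfMonomial q x y (0, b, a) = q⁻¹ ^ b • halfMonomial q x y (0, b, a + 1) := by
      rw [← h0]; simp [halfMonomial]
    rw [this]
    exact Submodule.smul_mem _ _ (halfMonomial_mem _)
  | 1 =>
    have : x * halfMonomial q x y (1, b, a) = halfMonomial q x y (0, b + 1, a) +
        (q * q⁻¹ ^ b) • halfMonomial q x y (1, b, a + 1) := by
      have hxy : x * y = qCommutator q x y + q • (y * x) := by simp [qCommutator]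
      calc x * halfMonomial q x y (1, b, a)
          = (x * y) * (qCommutator q x y ^ b * x ^ a) := by simp [halfMonomial, mul_assoc]
        _ = _ := by
          rw [hxy, add_mul, smul_mul_assoc, mul_assoc y, h0]
          simp [halfMonomial, pow_succ', mul_assoc, smul_smul]
    rw [this]
    exact add_mem (halfMonomial_mem _) (Submodule.smul_mem _ _ (halfMonomial_mem _))
  | c + 2 => simp [halfMonomial, pow_add, hy]

theorem halfSpan_le_adjoin :
    halfSpan q x y ≤ Subalgebra.toSubmodule (Algebra.adjoin ℂ {x, y}) := by
  have hx : x ∈ Algebra.adjoin ℂ {x, y} := Algebra.subset_adjoin (by simp)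
  have hy : y ∈ Algebra.adjoin ℂ {x, y} := Algebra.subset_adjoin (by simp)
  refine Submodule.span_le.mpr ?_
  rintro _ ⟨p, rfl⟩
  rw [SetLike.mem_coe, Subalgebra.mem_toSubmodule]
  exact mul_mem (mul_mem (pow_mem hy _)
    (pow_mem (sub_mem (mul_mem hx hy) (Subalgebra.smul_mem _ (mul_mem hy hx) _)) _)) (pow_mem hx _)

theorem halfSpan_fg {n : ℕ} (hq : q ≠ 0) (hq2 : q ^ 2 ≠ -1) (hx : x ^ n = 0) (hy : y ^ 2 = 0)
    (hs : x ^ 2 * y - (q + q⁻¹) • (x * y * x) + y * x ^ 2 = 0) : (halfSpan q x y).FG :=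
  Submodule.fg_span (finite_range_pow_mul_pow_mul_pow (finite_range_pow_of_pow_eq_zero hy)
    (finite_range_pow_of_pow_eq_zero (qCommutator_sq hq hq2 hy hs))
    (finite_range_pow_of_pow_eq_zero hx))

end HalfSpan

section QCommutes

variable {A : Type*} [Ring A] [Algebra ℂ A] {x g h : A}

/-- `x` and `g` commute up to a scalar. -/
def CommuteUpToScalar (x g : A) : Prop := ∃ c : ℂ, x * g = c • (g * x)

theorem CommuteUpToScalar.mul (hg : CommuteUpToScalar x g) (hh : CommuteUpToScalar x h) :
    CommuteUpToScalar x (g * h) := by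
  obtain ⟨c, hc⟩ := hg
  obtain ⟨d, hd⟩ := hh
  refine ⟨c * d, ?_⟩
  rw [← mul_assoc, hc, smul_mul_assoc, mul_assoc, hd, mul_smul_comm, smul_smul, mul_assoc]

theorem CommuteUpToScalar.pow (hg : CommuteUpToScalar x g) (n : ℕ) :
    CommuteUpToScalar x (g ^ n) := by
  obtain ⟨c, hc⟩ := hg
  exact ⟨c ^ n, mul_pow_of_qcomm hc n⟩

end QCommutes

namespace Relations

variable {A : Type*} [Ring A] [Algebra ℂ A] {ξ : ℂ} {l : ℕ} {k k' e f : Fin 2 → A} {s : A}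

/-- The monomials `k₁^a k₂^b σ^c` in the group-like generators. -/
def torusMonomial (k : Fin 2 → A) (s : A) (p : ℕ × ℕ × ℕ) : A :=
  k 0 ^ p.1 * k 1 ^ p.2.1 * s ^ p.2.2

/-- The group algebra of the group-like generators, as the span of their monomials. -/
def torusSpan (k : Fin 2 → A) (s : A) : Submodule ℂ A :=
  Submodule.span ℂ (Set.range (torusMonomial k s))

theorem torusMonomial_mem (p : ℕ × ℕ × ℕ) : torusMonomial k s p ∈ torusSpan k s :=
  Submodule.subset_span ⟨p, rfl⟩

theorem one_mem_torusSpan : 1 ∈ torusSpan k s := by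
  simpa [torusMonomial] using torusMonomial_mem (k := k) (s := s) (0, 0, 0)

theorem k_mem_torusSpan (i : Fin 2) : k i ∈ torusSpan k s := by
  fin_cases i
  · simpa [torusMonomial] using torusMonomial_mem (k := k) (s := s) (1, 0, 0)
  · simpa [torusMonomial] using torusMonomial_mem (k := k) (s := s) (0, 1, 0)

theorem k_mem_leftStabilizer_torusSpan (h : Relations ξ l k k' e f s) (i : Fin 2) :
    k i ∈ leftStabilizer (torusSpan k s) := by
  refine mem_leftStabilizer_span ?_
  rintro _ ⟨⟨a, b, c⟩, rfl⟩
  fin_cases i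
  · have : k 0 * torusMonomial k s (a, b, c) = torusMonomial k s (a + 1, b, c) := by
      simp [torusMonomial, pow_succ', mul_assoc]
    exact this ▸ torusMonomial_mem _
  · have hk : k 1 * k 0 ^ a = k 0 ^ a * k 1 := Commute.pow_right h.k_comm.symm a
    have : k 1 * torusMonomial k s (a, b, c) = torusMonomial k s (a, b + 1, c) := by
      simp only [torusMonomial, pow_succ', ← mul_assoc, hk]
    exact this ▸ torusMonomial_mem _

theorem s_mem_leftStabilizer_torusSpan (h : Relations ξ l k k' e f s) :
    s ∈ leftStabilizer (torusSpan k s) := by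
  refine mem_leftStabilizer_span ?_
  rintro _ ⟨⟨a, b, c⟩, rfl⟩
  have h0 : s * k 0 ^ a = k 0 ^ a * s := Commute.pow_right (h.s_k 0) a
  have h1 : s * k 1 ^ b = k 1 ^ b * s := Commute.pow_right (h.s_k 1) b
  have : s * torusMonomial k s (a, b, c) = torusMonomial k s (a, b, c + 1) := by
    simp only [torusMonomial, pow_succ', ← mul_assoc, h0]
    rw [mul_assoc _ s, h1, ← mul_assoc]
  exact this ▸ torusMonomial_mem _

theorem kInv_eq_pow (h : Relations ξ l k k' e f s) (hl : 0 < l) (hk : ∀ i, k i ^ l = 1)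
    (i : Fin 2) : k' i = k i ^ (l - 1) := by
  refine left_inv_eq_right_inv (h.kInv_mul_k i) ?_
  rw [← pow_succ', Nat.sub_add_cancel hl, hk]

theorem kInv_mem_torusSpan (h : Relations ξ l k k' e f s) (hl : 0 < l) (hk : ∀ i, k i ^ l = 1)
    (i : Fin 2) : k' i ∈ torusSpan k s := by
  have := pow_mem (h.k_mem_leftStabilizer_torusSpan i) (l - 1) 1 one_mem_torusSpan
  rwa [mul_one, ← h.kInv_eq_pow hl hk] at this

theorem torusSpan_fg (h : Relations ξ l k k' e f s) (hl : 0 < l) (hk : ∀ i, k i ^ l = 1) :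
    (torusSpan k s).FG :=
  Submodule.fg_span (finite_range_pow_mul_pow_mul_pow
    (finite_range_pow_of_pow_eq_one hl (hk 0)) (finite_range_pow_of_pow_eq_one hl (hk 1))
    (finite_range_pow_of_pow_eq_one two_pos h.s_sq))

theorem torusSpan_mul_self (h : Relations ξ l k k' e f s) :
    torusSpan k s * torusSpan k s ≤ torusSpan k s := by
  have : torusSpan k s ≤ Subalgebra.toSubmodule (leftStabilizer (torusSpan k s)) := by
    refine Submodule.span_le.mpr ?_
    rintro _ ⟨p, rfl⟩
    rw [SetLike.mem_coe, Subalgebra.mem_toSubmodule]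
    exact mul_mem (mul_mem (pow_mem (h.k_mem_leftStabilizer_torusSpan 0) _)
      (pow_mem (h.k_mem_leftStabilizer_torusSpan 1) _))
      (pow_mem h.s_mem_leftStabilizer_torusSpan _)
  exact Submodule.mul_le.mpr fun a ha b hb => this ha b hb

theorem mul_torusSpan_le {x : A} (hk : ∀ i, CommuteUpToScalar x (k i))
    (hs : CommuteUpToScalar x s) :
    Submodule.span ℂ {x} * torusSpan k s ≤ torusSpan k s * Submodule.span ℂ {x} := by
  rw [torusSpan, Submodule.span_mul_span, Submodule.span_le]
  rintro _ ⟨z, rfl, _, ⟨p, rfl⟩, rfl⟩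
  obtain ⟨c, hc⟩ := (((hk 0).pow p.1).mul ((hk 1).pow p.2.1)).mul (hs.pow p.2.2)
  simp only [torusMonomial, hc]
  exact Submodule.smul_mem _ _ (Submodule.mul_mem_mul (torusMonomial_mem p)
    (Submodule.mem_span_singleton_self z))

theorem e_mul_torusSpan_le (h : Relations ξ l k k' e f s) (hξ : ξ ≠ 0) (i : Fin 2) :
    Submodule.span ℂ {e i} * torusSpan k s ≤ torusSpan k s * Submodule.span ℂ {e i} :=
  mul_torusSpan_le (fun j => ⟨_, h.ek hξ j i⟩) ⟨_, h.es i⟩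

theorem f_mul_torusSpan_le (h : Relations ξ l k k' e f s) (hξ : ξ ≠ 0) (i : Fin 2) :
    Submodule.span ℂ {f i} * torusSpan k s ≤ torusSpan k s * Submodule.span ℂ {f i} :=
  mul_torusSpan_le (fun j => ⟨_, h.fk hξ j i⟩) ⟨_, h.fs i⟩

theorem span_singleton_mul_le_of_mem_leftStabilizer {X : Submodule ℂ A} {a : A}
    (h : a ∈ leftStabilizer X) : Submodule.span ℂ {a} * X ≤ X := by
  refine Submodule.mul_le.mpr fun b hb x hx => ?_
  obtain ⟨c, rfl⟩ := Submodule.mem_span_singleton.mp hb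
  rw [smul_mul_assoc]
  exact X.smul_mem c (h x hx)

theorem mem_leftStabilizer_of_span_singleton_mul_le {X : Submodule ℂ A} {a : A}
    (h : Submodule.span ℂ {a} * X ≤ X) : a ∈ leftStabilizer X :=
  fun _ hx => h (Submodule.mul_mem_mul (Submodule.mem_span_singleton_self a) hx)

theorem e_mem_leftStabilizer_halfSpan (h : Relations ξ l k k' e f s) (hξ : ξ ≠ 0) (i : Fin 2) :
    e i ∈ leftStabilizer (halfSpan ξ (e 0) (e 1)) := by
  fin_cases i
  · exact left_mem_leftStabilizer_halfSpan hξ h.e_sq h.serre_e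
  · exact right_mem_leftStabilizer_halfSpan

theorem f_mem_leftStabilizer_halfSpan (h : Relations ξ l k k' e f s) (hξ : ξ ≠ 0) (i : Fin 2) :
    f i ∈ leftStabilizer (halfSpan ξ (f 0) (f 1)) := by
  fin_cases i
  · exact left_mem_leftStabilizer_halfSpan hξ h.f_sq h.serre_f
  · exact right_mem_leftStabilizer_halfSpan

theorem e_mem_leftStabilizer_torusSpan_mul (h : Relations ξ l k k' e f s) (hξ : ξ ≠ 0)
    (i : Fin 2) : e i ∈ leftStabilizer (torusSpan k s * halfSpan ξ (e 0) (e 1)) := by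
  refine mem_leftStabilizer_of_span_singleton_mul_le ?_
  rw [← mul_assoc]
  grw [h.e_mul_torusSpan_le hξ i, mul_assoc,
    span_singleton_mul_le_of_mem_leftStabilizer (h.e_mem_leftStabilizer_halfSpan hξ i)]

/-- Moving `f_i` to the right past a polynomial in the `e_j` leaves an error in the positive Borel
part. -/
theorem f_mul_halfSpan_le (h : Relations ξ l k k' e f s) (hξ : ξ ≠ 0) (hl : 0 < l)
    (hk : ∀ i, k i ^ l = 1) (i : Fin 2) :
    Submodule.span ℂ {f i} * halfSpan ξ (e 0) (e 1) ≤
      halfSpan ξ (e 0) (e 1) * Submodule.span ℂ {f i} ⊔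
        torusSpan k s * halfSpan ξ (e 0) (e 1) := by
  set E := halfSpan ξ (e 0) (e 1)
  set Y := E * Submodule.span ℂ {f i} ⊔ torusSpan k s * E with hY
  have hf1 : f i ∈ Y := Submodule.mem_sup_left (by
    simpa using Submodule.mul_mem_mul one_mem_halfSpan (Submodule.mem_span_singleton_self (f i)))
  have heY (j : Fin 2) : e j ∈ leftStabilizer Y := by
    refine mem_leftStabilizer_of_span_singleton_mul_le ?_
    rw [hY, Submodule.mul_sup, ← mul_assoc]
    exact sup_le_sup (mul_le_mul_left (span_singleton_mul_le_of_mem_leftStabilizer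
      (h.e_mem_leftStabilizer_halfSpan hξ j)) _) (span_singleton_mul_le_of_mem_leftStabilizer
      (h.e_mem_leftStabilizer_torusSpan_mul hξ j))
  have hfe (j : Fin 2) (x : A) (hx : x ∈ E) (hfx : f i * x ∈ Y) : f i * (e j * x) ∈ Y := by
    by_cases hij : j = i
    · subst hij
      have h2 : f j * e j = (-1 : ℂ) ^ parity j • (e j * f j - (ξ - ξ⁻¹)⁻¹ • (k j - k' j)) := by
        rw [← h.e_f, sub_sub_cancel, smul_smul, ← mul_pow]; simp
      rw [← mul_assoc, h2, smul_mul_assoc, sub_mul, smul_mul_assoc, sub_mul, mul_assoc]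
      refine Submodule.smul_mem _ _ (sub_mem (heY j _ hfx) (Submodule.smul_mem _ _ ?_))
      exact Submodule.mem_sup_right (sub_mem (Submodule.mul_mem_mul (k_mem_torusSpan j) hx)
        (Submodule.mul_mem_mul (h.kInv_mem_torusSpan hl hk j) hx))
    · rw [← mul_assoc, ← h.e_f_comm j i hij, mul_assoc]
      exact heY j _ hfx
  have hX : Subalgebra.toSubmodule (Algebra.adjoin ℂ {e 0, e 1}) ≤
      E ⊓ Y.comap (LinearMap.mulLeft ℂ (f i)) := by
    have hS (j : Fin 2) : e j ∈ leftStabilizer (E ⊓ Y.comap (LinearMap.mulLeft ℂ (f i))) :=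
      fun x hx => ⟨h.e_mem_leftStabilizer_halfSpan hξ j x hx.1, hfe j x hx.1 hx.2⟩
    refine adjoin_le_of_leftStabilizer ⟨one_mem_halfSpan, by simpa using hf1⟩ ?_
    rintro _ (rfl | rfl)
    · exact hS 0
    · exact hS 1
  refine Submodule.mul_le.mpr fun b hb x hx => ?_
  obtain ⟨c, rfl⟩ := Submodule.mem_span_singleton.mp hb
  rw [smul_mul_assoc]
  exact Submodule.smul_mem _ _ (hX (halfSpan_le_adjoin hx)).2

/-- The product `U⁰ U⁺ U⁻`. -/
def triangularSpan (ξ : ℂ) (k e f : Fin 2 → A) (s : A) : Submodule ℂ A :=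
  torusSpan k s * halfSpan ξ (e 0) (e 1) * halfSpan ξ (f 0) (f 1)

/-- Triangular decomposition: an algebra generated by elements satisfying the relations of the
small quantum group is spanned by the products of monomials in the group-likes, in the `e`s and
in the `f`s. -/
theorem triangularSpan_eq_top (h : Relations ξ l k k' e f s) (hξ : ξ ≠ 0) (hl : 0 < l)
    (hk : ∀ i, k i ^ l = 1)
    (hgen : Algebra.adjoin ℂ (Set.range k ∪ Set.range e ∪ Set.range f ∪ {s}) = ⊤) :
    triangularSpan ξ k e f s = ⊤ := by
  rw [eq_top_iff, ← Algebra.top_toSubmodule, ← hgen]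
  refine adjoin_le_of_leftStabilizer ?_ ?_
  · simpa [triangularSpan] using Submodule.mul_mem_mul (Submodule.mul_mem_mul
      (one_mem_torusSpan (k := k) (s := s)) (one_mem_halfSpan (q := ξ) (x := e 0) (y := e 1)))
      (one_mem_halfSpan (q := ξ) (x := f 0) (y := f 1))
  · have htorus {a : A} (ha : a ∈ leftStabilizer (torusSpan k s)) :
        a ∈ leftStabilizer (triangularSpan ξ k e f s) := by
      refine mem_leftStabilizer_of_span_singleton_mul_le ?_
      rw [triangularSpan, ← mul_assoc, ← mul_assoc]
      grw [span_singleton_mul_le_of_mem_leftStabilizer ha]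
    rintro _ (((⟨i, rfl⟩ | ⟨i, rfl⟩) | ⟨i, rfl⟩) | rfl)
    · exact htorus (h.k_mem_leftStabilizer_torusSpan i)
    · refine mem_leftStabilizer_of_span_singleton_mul_le ?_
      rw [triangularSpan, ← mul_assoc]
      grw [span_singleton_mul_le_of_mem_leftStabilizer
        (h.e_mem_leftStabilizer_torusSpan_mul hξ i)]
    · refine mem_leftStabilizer_of_span_singleton_mul_le ?_
      rw [triangularSpan, ← mul_assoc, ← mul_assoc]
      grw [h.f_mul_torusSpan_le hξ i]
      rw [mul_assoc (torusSpan k s)]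
      grw [h.f_mul_halfSpan_le hξ hl hk i]
      rw [Submodule.mul_sup, Submodule.sup_mul]
      refine sup_le ?_ ?_
      · rw [← mul_assoc, mul_assoc _ (Submodule.span ℂ {f i})]
        grw [span_singleton_mul_le_of_mem_leftStabilizer (h.f_mem_leftStabilizer_halfSpan hξ i)]
      · rw [← mul_assoc]
        grw [h.torusSpan_mul_self]
    · exact htorus h.s_mem_leftStabilizer_torusSpan

theorem triangularSpan_fg (h : Relations ξ l k k' e f s) (hξ : ξ ≠ 0) (hξ2 : ξ ^ 2 ≠ -1)
    (hl : 0 < l) (hk : ∀ i, k i ^ l = 1) : (triangularSpan ξ k e f s).FG :=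
  ((h.torusSpan_fg hl hk).mul (halfSpan_fg hξ hξ2 h.e_pow h.e_sq h.serre_e)).mul
    (halfSpan_fg hξ hξ2 h.f_pow h.f_sq h.serre_f)

end Relations

/-! ### Parity of the elements of weight zero -/

section Homogeneous

variable {A : Type*} [Ring A] [Algebra ℂ A] {ξ : ℂ} {z s x y : A} {m n : ℤ}

/-- `x` has degree `n` with respect to conjugation by `z` and parity `n` with respect to
conjugation by `s`. -/
def IsHomogeneous (ξ : ℂ) (z s : A) (n : ℤ) (x : A) : Prop :=
  z * x = ξ ^ n • (x * z) ∧ s * x = (-1 : ℂ) ^ n • (x * s)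

namespace IsHomogeneous

theorem zero : IsHomogeneous ξ z s n 0 := by simp [IsHomogeneous]

theorem one : IsHomogeneous ξ z s 0 1 := by simp [IsHomogeneous]

theorem mul (hξ : ξ ≠ 0) (hx : IsHomogeneous ξ z s m x) (hy : IsHomogeneous ξ z s n y) :
    IsHomogeneous ξ z s (m + n) (x * y) := by
  constructor
  · rw [← mul_assoc, hx.1, smul_mul_assoc, mul_assoc, hy.1, mul_smul_comm, smul_smul, mul_assoc,
      zpow_add₀ hξ]
  · rw [← mul_assoc, hx.2, smul_mul_assoc, mul_assoc, hy.2, mul_smul_comm, smul_smul, mul_assoc,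
      zpow_add₀ (by norm_num)]

theorem pow (hξ : ξ ≠ 0) (hx : IsHomogeneous ξ z s n x) (a : ℕ) :
    IsHomogeneous ξ z s (a * n) (x ^ a) := by
  induction a with
  | zero => simpa using one
  | succ a ih =>
    rw [pow_succ, Nat.cast_succ, add_mul, one_mul]
    exact ih.mul hξ hx

theorem smul (hx : IsHomogeneous ξ z s n x) (c : ℂ) : IsHomogeneous ξ z s n (c • x) :=
  ⟨by rw [mul_smul_comm, hx.1, smul_mul_assoc, smul_comm],
    by rw [mul_smul_comm, hx.2, smul_mul_assoc, smul_comm]⟩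

theorem sub (hx : IsHomogeneous ξ z s n x) (hy : IsHomogeneous ξ z s n y) :
    IsHomogeneous ξ z s n (x - y) :=
  ⟨by rw [mul_sub, hx.1, hy.1, sub_mul, smul_sub], by rw [mul_sub, hx.2, hy.2, sub_mul, smul_sub]⟩

/-- If `x` has degree zero, `y` degree `n` and `y² = 0`, then the ordered monomials in `x`, `y`
and their `q`-commutator have degree `0`, `n` or `2 n`, since those in which a root vector of
degree `n` is repeated vanish. -/
theorem halfMonomial {q : ℂ} (hξ : ξ ≠ 0) (hx : IsHomogeneous ξ z s 0 x)
    (hy : IsHomogeneous ξ z s n y) (hy2 : y ^ 2 = 0) (hw : qCommutator q x y ^ 2 = 0)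
    (p : ℕ × ℕ × ℕ) : ∃ c b : ℕ, c < 2 ∧ b < 2 ∧
      IsHomogeneous ξ z s ((c + b) * n) (halfMonomial q x y p) := by
  obtain ⟨c, b, a⟩ := p
  by_cases hc : c < 2
  · by_cases hb : b < 2
    · refine ⟨c, b, hc, hb, ?_⟩
      have hxy : IsHomogeneous ξ z s n (x * y) := by simpa using hx.mul hξ hy
      have hyx : IsHomogeneous ξ z s n (y * x) := by simpa using hy.mul hξ hx
      have := ((hy.pow hξ c).mul hξ ((hxy.sub (hyx.smul q)).pow hξ b)).mul hξ (hx.pow hξ a)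
      rw [mul_zero, add_zero, ← add_mul] at this
      exact this
    · refine ⟨0, 0, by norm_num, by norm_num, ?_⟩
      simp only [SmallQuantumSl21.halfMonomial, pow_eq_zero_of_le (not_lt.mp hb) hw, mul_zero,
        zero_mul]
      exact zero
  · refine ⟨0, 0, by norm_num, by norm_num, ?_⟩
    simp only [SmallQuantumSl21.halfMonomial, pow_eq_zero_of_le (not_lt.mp hc) hy2, zero_mul]
    exact zero

end IsHomogeneous

/-- The operator `x ↦ p(Ad z) (s x - x s) z²` with `p(t) = (t - ξ) (t - ξ⁻¹)`. It annihilates the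
homogeneous elements of even degree, by the factor `s x - x s`, and those of degree `±1`. -/
noncomputable def oddFilter (ξ : ℂ) (z s : A) : A →ₗ[ℂ] A :=
  (LinearMap.mulLeft ℂ (z * z) - (ξ + ξ⁻¹) • (LinearMap.mulLeft ℂ z ∘ₗ LinearMap.mulRight ℂ z)
    + LinearMap.mulRight ℂ (z * z)) ∘ₗ (LinearMap.mulLeft ℂ s - LinearMap.mulRight ℂ s)

theorem oddFilter_eq_zero (hξ : ξ ≠ 0) (hzs : z * s = s * z) (hx : IsHomogeneous ξ z s n x)
    (h1 : -2 ≤ n) (h2 : n ≤ 2) : oddFilter ξ z s x = 0 := by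
  obtain ⟨hx1, hx2⟩ := hx
  have h3 : z * (x * s) = ξ ^ n • (x * s * z) := by
    rw [← mul_assoc, hx1, smul_mul_assoc, mul_assoc, hzs, mul_assoc]
  have h4 : oddFilter ξ z s x = ((-1 : ℂ) ^ n - 1) • (ξ ^ n * ξ ^ n - (ξ + ξ⁻¹) * ξ ^ n + 1) •
      (x * s * (z * z)) := by
    have : s * x - x * s = ((-1 : ℂ) ^ n - 1) • (x * s) := by rw [hx2, sub_smul, one_smul]
    simp only [oddFilter, LinearMap.comp_apply, LinearMap.sub_apply, LinearMap.add_apply,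
      LinearMap.smul_apply, LinearMap.mulLeft_apply, LinearMap.mulRight_apply, this, map_smul]
    have h5 : z * z * (x * s) = (ξ ^ n * ξ ^ n) • (x * s * (z * z)) := by
      rw [mul_assoc, h3, mul_smul_comm, ← mul_assoc, h3, smul_mul_assoc, smul_smul, mul_assoc]
    have h6 : z * (x * s * z) = ξ ^ n • (x * s * (z * z)) := by
      rw [← mul_assoc, h3, smul_mul_assoc, mul_assoc]
    rw [h5, h6]
    module
  rw [h4]
  obtain rfl | rfl | rfl | rfl | rfl : n = -2 ∨ n = -1 ∨ n = 0 ∨ n = 1 ∨ n = 2 := by omega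
  · norm_num
  · rw [zpow_neg_one ξ, show ξ⁻¹ * ξ⁻¹ - (ξ + ξ⁻¹) * ξ⁻¹ + 1 = 0 by field_simp; ring, zero_smul,
      smul_zero]
  · norm_num
  · rw [zpow_one ξ, show ξ * ξ - (ξ + ξ⁻¹) * ξ + 1 = 0 by field_simp; ring, zero_smul, smul_zero]
  · norm_num

theorem eq_zero_of_oddFilter_eq_zero (hξ : ξ ≠ 0) (hξ1 : ξ ≠ 1) (hz : IsUnit z) (hs : IsUnit s)
    (hzs : z * s = s * z) (hzx : z * x = x * z) (hsx : s * x = -(x * s))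
    (h : oddFilter ξ z s x = 0) : x = 0 := by
  have h1 : oddFilter ξ z s x = (2 * (ξ - 1) ^ 2 * ξ⁻¹) • (x * s * (z * z)) := by
    simp only [oddFilter, LinearMap.comp_apply, LinearMap.sub_apply, LinearMap.add_apply,
      LinearMap.smul_apply, LinearMap.mulLeft_apply, LinearMap.mulRight_apply, hsx]
    have h3 : z * (x * s) = x * s * z := by
      rw [← mul_assoc, hzx, mul_assoc, hzs, mul_assoc]
    have h5 : z * z * (x * s) = x * s * (z * z) := by
      rw [mul_assoc, h3, ← mul_assoc, h3, mul_assoc]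
    have h6 : z * (x * s * z) = x * s * (z * z) := by
      rw [← mul_assoc, h3, mul_assoc]
    simp only [mul_sub, mul_neg, sub_mul, neg_mul, h5, h6]
    match_scalars
    field_simp
    ring
  rw [h1, smul_eq_zero] at h
  have h2 := h.resolve_left (by
    simp [hξ, sub_ne_zero.mpr hξ1])
  rwa [(hz.mul hz).mul_left_eq_zero, hs.mul_left_eq_zero] at h2

end Homogeneous

namespace Relations

variable {A : Type*} [Ring A] [Algebra ℂ A] {ξ : ℂ} {l : ℕ} {k k' e f : Fin 2 → A} {s : A}

theorem s_mul_weight (h : Relations ξ l k k' e f s) : k 0 * k 1 ^ 2 * s = s * (k 0 * k 1 ^ 2) :=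
  (Commute.mul_right (h.s_k 0) (Commute.pow_right (h.s_k 1) 2)).symm

/-- The weight under `k₁ k₂²`: the coefficients are chosen so that `e₁` and `f₁`, of weights
`±(2, -1)`, have degree zero, while `e₂` and `f₂`, of weights `±(-1, 0)`, have degree `∓1`. -/
theorem isHomogeneous_of_weight {x : A} {a b n : ℤ} (hξ : ξ ≠ 0) (h0 : k 0 * x = ξ ^ a • (x * k 0))
    (h1 : k 1 * x = ξ ^ b • (x * k 1)) (hs : s * x = (-1 : ℂ) ^ n • (x * s))
    (hn : a + 2 * b = n) : IsHomogeneous ξ (k 0 * k 1 ^ 2) s n x := by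
  refine ⟨?_, hs⟩
  rw [mul_assoc, pow_mul_of_qcomm h1, mul_smul_comm, ← mul_assoc, h0, smul_mul_assoc, smul_smul,
    mul_assoc, ← hn, zpow_add₀ hξ, mul_comm (ξ ^ a), mul_comm 2 b, zpow_mul]
  norm_cast

theorem isHomogeneous_e (h : Relations ξ l k k' e f s) (hξ : ξ ≠ 0) (i : Fin 2) :
    IsHomogeneous ξ (k 0 * k 1 ^ 2) s (-parity i) (e i) := by
  refine isHomogeneous_of_weight hξ (h.ke 0 i) (h.ke 1 i) ?_ ?_
  · rw [h.s_e, zpow_neg, zpow_natCast, ← inv_pow]; norm_num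
  · fin_cases i <;> simp [cartan, parity]

theorem isHomogeneous_f (h : Relations ξ l k k' e f s) (hξ : ξ ≠ 0) (i : Fin 2) :
    IsHomogeneous ξ (k 0 * k 1 ^ 2) s (parity i) (f i) := by
  refine isHomogeneous_of_weight hξ (h.kf 0 i) (h.kf 1 i) ?_ ?_
  · rw [h.s_f, zpow_natCast]
  · fin_cases i <;> simp [cartan, parity]

theorem isHomogeneous_torusMonomial (h : Relations ξ l k k' e f s) (hξ : ξ ≠ 0)
    (p : ℕ × ℕ × ℕ) : IsHomogeneous ξ (k 0 * k 1 ^ 2) s 0 (torusMonomial k s p) := by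
  have hk (i : Fin 2) : IsHomogeneous ξ (k 0 * k 1 ^ 2) s 0 (k i) :=
    isHomogeneous_of_weight (a := 0) (b := 0) hξ (by simp [h.kk 0 i]) (by simp [h.kk 1 i])
      (by simp [h.s_k]) (by simp)
  have hs : IsHomogeneous ξ (k 0 * k 1 ^ 2) s 0 s := ⟨by simp [h.s_mul_weight], by simp⟩
  simpa [torusMonomial] using
    (((hk 0).pow hξ p.1).mul hξ ((hk 1).pow hξ p.2.1)).mul hξ (hs.pow hξ p.2.2)

/-- An odd element commuting with `k₁ k₂²` vanishes: the degree of a monomial in the triangular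
decomposition is between `-2` and `2`, and conjugation by `k₁ k₂²` separates `±1` from `0`. -/
theorem eq_zero_of_commute_of_odd (h : Relations ξ l k k' e f s) (hξ : ξ ≠ 0) (hξ1 : ξ ≠ 1)
    (hξ2 : ξ ^ 2 ≠ -1) (htop : triangularSpan ξ k e f s = ⊤) {x : A}
    (hx : k 0 * k 1 ^ 2 * x = x * (k 0 * k 1 ^ 2)) (hsx : s * x = -(x * s)) : x = 0 := by
  have hku (i : Fin 2) : IsUnit (k i) := ⟨⟨k i, k' i, h.k_mul_kInv i, h.kInv_mul_k i⟩, rfl⟩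
  refine eq_zero_of_oddFilter_eq_zero hξ hξ1 ((hku 0).mul ((hku 1).pow 2))
    (.of_pow_eq_one h.s_sq two_ne_zero) h.s_mul_weight hx hsx ?_
  suffices triangularSpan ξ k e f s ≤ LinearMap.ker (oddFilter ξ (k 0 * k 1 ^ 2) s) from
    this (htop ▸ Submodule.mem_top)
  rw [triangularSpan, torusSpan, halfSpan, halfSpan, Submodule.span_mul_span,
    Submodule.span_mul_span, Submodule.span_le]
  rintro _ ⟨_, ⟨_, ⟨p, rfl⟩, _, ⟨p', rfl⟩, rfl⟩, _, ⟨p'', rfl⟩, rfl⟩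
  have he0 : IsHomogeneous ξ (k 0 * k 1 ^ 2) s 0 (e 0) := by
    simpa [parity] using h.isHomogeneous_e hξ 0
  have hf0 : IsHomogeneous ξ (k 0 * k 1 ^ 2) s 0 (f 0) := by
    simpa [parity] using h.isHomogeneous_f hξ 0
  obtain ⟨c, b, hc, hb, hE⟩ := IsHomogeneous.halfMonomial hξ he0 (h.isHomogeneous_e hξ 1) h.e_sq
    (qCommutator_sq hξ hξ2 h.e_sq h.serre_e) p'
  obtain ⟨c', b', hc', hb', hF⟩ := IsHomogeneous.halfMonomial hξ hf0 (h.isHomogeneous_f hξ 1) h.f_sq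
    (qCommutator_sq hξ hξ2 h.f_sq h.serre_f) p''
  refine oddFilter_eq_zero hξ h.s_mul_weight
    (((h.isHomogeneous_torusMonomial hξ p).mul hξ hE).mul hξ hF) ?_ ?_ <;>
  · simp only [parity, Matrix.cons_val_one, Matrix.cons_val_fin_one, Nat.cast_one]
    omega

/-- The values of a character on all generators but `σ` are forced: it vanishes on the `e`s
and `f`s, which have nontrivial weight, so that its values on the `k`s are both square roots and
`ℓ`-th roots of unity. -/
theorem character_eq (h : Relations ξ l k k' e f s) (hξ : ξ ≠ 0) (hξ1 : ξ ≠ 1)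
    (hξ2 : ξ ^ 2 ≠ 1) (hl : Odd l) (hk : ∀ i, k i ^ l = 1) (α : A →ₐ[ℂ] ℂ) :
    (∀ i, α (k i) = 1) ∧ (∀ i, α (e i) = 0) ∧ (∀ i, α (f i) = 0) := by
  have hk0 (i : Fin 2) : α (k i) ≠ 0 := by
    intro h0
    have := congrArg α (hk i)
    rw [map_pow, h0, map_one, zero_pow hl.pos.ne'] at this
    exact zero_ne_one this
  have hvanish {c a : ℂ} {d : ℂ} (hd : d ≠ 0) (hc : c ≠ 1) (h : d * a = c * (a * d)) : a = 0 := by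
    have : (1 - c) * d * a = 0 := by linear_combination h
    simpa [sub_ne_zero.mpr hc.symm, hd] using this
  have he (i : Fin 2) : α (e i) = 0 := by
    fin_cases i
    · have := congrArg α (h.ke 0 0)
      simp only [map_mul, map_smul, smul_eq_mul] at this
      refine hvanish (hk0 0) ?_ this
      simp only [cartan, Matrix.cons_val_zero, ne_eq]
      exact mod_cast hξ2
    · have := congrArg α (h.ke 0 1)
      simp only [map_mul, map_smul, smul_eq_mul] at this
      exact hvanish (hk0 0) (by simpa [cartan] using hξ1) this
  have hf (i : Fin 2) : α (f i) = 0 := by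
    fin_cases i
    · have := congrArg α (h.kf 0 0)
      simp only [map_mul, map_smul, smul_eq_mul] at this
      refine hvanish (hk0 0) ?_ this
      simp only [cartan, Matrix.cons_val_zero, ne_eq, zpow_neg, inv_eq_one]
      exact mod_cast hξ2
    · have := congrArg α (h.kf 0 1)
      simp only [map_mul, map_smul, smul_eq_mul] at this
      exact hvanish (hk0 0) (by simpa [cartan] using hξ1) this
  refine ⟨fun i => ?_, he, hf⟩
  have hξξ : ξ - ξ⁻¹ ≠ 0 := by
    intro h0
    apply hξ2
    field_simp at h0
    linear_combination h0
  have h1 := congrArg α (h.e_f i)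
  have h2 := congrArg α (h.k_mul_kInv i)
  have h3 := congrArg α (hk i)
  simp only [map_sub, map_smul, map_mul, he, hf, smul_eq_mul, mul_zero, sub_zero, map_one,
    map_pow] at h1 h2 h3
  have h4 : α (k' i) = α (k i) := by
    simpa [hξξ, sub_eq_zero, eq_comm (a := α (k i))] using h1.symm
  have h5 : α (k i) ^ 2 = 1 := by rw [pow_two]; nth_rw 2 [← h4]; exact h2
  obtain ⟨m, rfl⟩ := hl
  rwa [pow_succ, pow_mul, h5, one_pow, one_mul] at h3

theorem map {B : Type*} [Ring B] [Algebra ℂ B] (h : Relations ξ l k k' e f s) (φ : A →ₐ[ℂ] B) :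
    Relations ξ l (φ ∘ k) (φ ∘ k') (φ ∘ e) (φ ∘ f) (φ s) where
  k_comm := by simpa using congrArg φ h.k_comm
  k_mul_kInv i := by simpa using congrArg φ (h.k_mul_kInv i)
  kInv_mul_k i := by simpa using congrArg φ (h.kInv_mul_k i)
  k_e i j := by simpa using congrArg φ (h.k_e i j)
  k_f i j := by simpa [-zpow_neg] using congrArg φ (h.k_f i j)
  e_f i := by simpa using congrArg φ (h.e_f i)
  e_f_comm i j hij := by simpa using congrArg φ (h.e_f_comm i j hij)
  e_sq := by simpa using congrArg φ h.e_sq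
  f_sq := by simpa using congrArg φ h.f_sq
  serre_e := by simpa using congrArg φ h.serre_e
  serre_f := by simpa using congrArg φ h.serre_f
  e_pow := by simpa using congrArg φ h.e_pow
  f_pow := by simpa using congrArg φ h.f_pow
  s_sq := by simpa using congrArg φ h.s_sq
  s_k i := by simpa using congrArg φ (h.s_k i)
  s_e i := by simpa using congrArg φ (h.s_e i)
  s_f i := by simpa using congrArg φ (h.s_f i)

end Relations

/-! ### The small quantum group -/

namespace SmallQuantumGroup

open Coalgebra HopfAlgebra

/-- The projection from `U^σ` to the small quantum group. -/
noncomputable def mk (l : ℕ) : Usigma l →ₐ[ℂ] SmallQuantumGroup l :=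
  Ideal.Quotient.mkₐ ℂ (kIdeal l)

theorem mk_surjective (l : ℕ) : Function.Surjective (mk l) :=
  Ideal.Quotient.mkₐ_surjective ℂ (kIdeal l)

theorem relations (l : ℕ) : Relations (xi l) l (mk l ∘ Usigma.k l) (mk l ∘ Usigma.kInv l)
    (mk l ∘ Usigma.e l) (mk l ∘ Usigma.f l) (mk l (Usigma.s l)) :=
  (Usigma.relations l).map (mk l)

theorem k_pow (l : ℕ) (i : Fin 2) : (mk l ∘ Usigma.k l) i ^ l = 1 := by
  rw [Function.comp_apply, ← map_pow, ← map_one (mk l)]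
  refine Ideal.Quotient.eq.mpr ?_
  simpa using mem_kIdeal l i 1

theorem adjoin_eq_top (l : ℕ) (hl : 0 < l) :
    Algebra.adjoin ℂ (Set.range (mk l ∘ Usigma.k l) ∪ Set.range (mk l ∘ Usigma.e l) ∪
      Set.range (mk l ∘ Usigma.f l) ∪ {mk l (Usigma.s l)}) = ⊤ := by
  rw [eq_top_iff]
  rintro x -
  obtain ⟨x, rfl⟩ := mk_surjective l x
  induction x using Usigma.induction with
  | halg c => rw [AlgHom.commutes]; exact Subalgebra.algebraMap_mem _ c
  | hadd x y hx hy => rw [map_add]; exact add_mem hx hy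
  | hmul x y hx hy => rw [map_mul]; exact mul_mem hx hy
  | hk i => exact Algebra.subset_adjoin (Or.inl (Or.inl (Or.inl ⟨i, rfl⟩)))
  | hk' i =>
    have := (relations l).kInv_eq_pow hl (k_pow l) i
    rw [Function.comp_apply] at this
    rw [this]
    refine Subalgebra.pow_mem _ (Algebra.subset_adjoin ?_) _
    exact Or.inl (Or.inl (Or.inl ⟨i, rfl⟩))
  | he i => exact Algebra.subset_adjoin (Or.inl (Or.inl (Or.inr ⟨i, rfl⟩)))
  | hf i => exact Algebra.subset_adjoin (Or.inl (Or.inr ⟨i, rfl⟩))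
  | hs => exact Algebra.subset_adjoin (Or.inr rfl)

variable (l : ℕ) [Fact (Odd l)]

theorem xi_sq_ne_one (hl : 3 ≤ l) : xi l ^ 2 ≠ 1 := by
  simpa using (xi_sq_primitive l Fact.out).pow_ne_one_of_pos_of_lt one_ne_zero (by omega)

theorem xi_ne_one (hl : 3 ≤ l) : xi l ≠ 1 := fun h => xi_sq_ne_one l hl (by rw [h, one_pow])

theorem xi_sq_ne_neg_one (hl : 3 ≤ l) : xi l ^ 2 ≠ -1 := fun h =>
  (xi_sq_primitive l Fact.out).pow_ne_one_of_pos_of_lt two_ne_zero (by omega)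
    (by rw [h]; norm_num)

theorem counit_mk (x : Usigma l) : counit (R := ℂ) (mk l x) = counit (R := ℂ) x := rfl

theorem antipode_mk (x : Usigma l) : antipode ℂ (mk l x) = mk l (Usigma.antipodeLin l x) := rfl

/-- Every generator is, up to a unit, the image of a generator under the antipode. -/
theorem antipode_surjective : Function.Surjective (antipode ℂ (A := SmallQuantumGroup l)) := by
  have h := Usigma.relations l
  have hx (x : Usigma l) : ∃ y, Usigma.antipodeLin l y = x := by
    induction x using Usigma.induction with
    | halg c => exact ⟨_, Usigma.antipodeLin_algebraMap l c⟩
    | hadd x y hx hy =>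
      obtain ⟨x, rfl⟩ := hx
      obtain ⟨y, rfl⟩ := hy
      exact ⟨x + y, map_add _ _ _⟩
    | hmul x y hx hy =>
      obtain ⟨x, rfl⟩ := hx
      obtain ⟨y, rfl⟩ := hy
      exact ⟨y * x, Usigma.antipodeLin_mul l _ _⟩
    | hk i => exact ⟨_, Usigma.antipodeLin_kInv l i⟩
    | hk' i => exact ⟨_, Usigma.antipodeLin_k l i⟩
    | he i =>
      refine ⟨-(Usigma.e l i * (Usigma.s l ^ parity i * Usigma.k l i)), ?_⟩
      rw [map_neg, Usigma.antipodeLin_mul, Usigma.antipodeLin_mul, Usigma.antipodeLin_k,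
        Usigma.antipodeLin_s_pow, Usigma.antipodeLin_e, mul_neg, neg_neg, mul_assoc,
        ← mul_assoc (Usigma.s l ^ _), ← mul_assoc (Usigma.s l ^ _), Usigma.s_pow_sq, one_mul,
        ← mul_assoc, h.kInv_mul_k, one_mul]
    | hf i =>
      refine ⟨-(Usigma.kInv l i * (Usigma.f l i * Usigma.s l ^ parity i)), ?_⟩
      rw [map_neg, Usigma.antipodeLin_mul, Usigma.antipodeLin_mul, Usigma.antipodeLin_kInv,
        Usigma.antipodeLin_s_pow, Usigma.antipodeLin_f, mul_neg, neg_mul, neg_neg, mul_assoc,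
        mul_assoc, mul_assoc, h.kInv_mul_k, mul_one, ← mul_assoc, Usigma.s_pow_sq, one_mul]
    | hs => exact ⟨_, Usigma.antipodeLin_s l⟩
  intro x
  obtain ⟨x, rfl⟩ := mk_surjective l x
  obtain ⟨y, rfl⟩ := hx x
  exact ⟨mk l y, antipode_mk l y⟩

theorem finite (hl : 3 ≤ l) : Module.Finite ℂ (SmallQuantumGroup l) :=
  ⟨(relations l).triangularSpan_eq_top (xi_ne_zero l) (by omega) (k_pow l)
    (adjoin_eq_top l (by omega)) ▸ (relations l).triangularSpan_fg (xi_ne_zero l)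
      (xi_sq_ne_neg_one l hl) (by omega) (k_pow l)⟩

/-- If the right action on a nonzero left integral is by a character `α` trivial on `k₁` and `k₂`,
then `α(σ) = 1`: otherwise the integral would anticommute with `σ`, while commuting with
`k₁ k₂²`. -/
theorem character_s_eq_one (hl : 3 ≤ l) {t : SmallQuantumGroup l}
    (ht : t ∈ leftIntegrals ℂ (SmallQuantumGroup l)) (ht0 : t ≠ 0)
    {α : SmallQuantumGroup l →ₐ[ℂ] ℂ} (hα : ∀ x, t * x = α x • t)
    (hk : ∀ i, α (mk l (Usigma.k l i)) = 1) : α (mk l (Usigma.s l)) = 1 := by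
  have hs : α (mk l (Usigma.s l)) ^ 2 = 1 := by
    rw [← map_pow, (relations l).s_sq, map_one]
  have hs' : α (mk l (Usigma.s l)) = 1 ∨ α (mk l (Usigma.s l)) = -1 := by simpa using hs
  refine hs'.resolve_right fun h => ht0 ?_
  refine (relations l).eq_zero_of_commute_of_odd (xi_ne_zero l) (xi_ne_one l hl)
    (xi_sq_ne_neg_one l hl) ((relations l).triangularSpan_eq_top (xi_ne_zero l) (by omega)
      (k_pow l) (adjoin_eq_top l (by omega))) ?_ ?_
  · simp only [Function.comp_apply]
    rw [ht, hα, Bialgebra.counit_mul, Bialgebra.counit_pow, counit_mk, counit_mk,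
      Usigma.counit_k, Usigma.counit_k, map_mul, map_pow, hk, hk]
  · rw [ht, hα, counit_mk, Usigma.counit_s, h, neg_smul, neg_neg]

theorem isUnimodular (hl : 3 ≤ l) : IsUnimodular ℂ (SmallQuantumGroup l) := by
  have : FiniteDimensional ℂ (SmallQuantumGroup l) := finite l hl
  refine isUnimodular_of_surjective_antipode (antipode_surjective l) fun t ht α ht0 hα => ?_
  obtain ⟨hk, he, hf⟩ := (relations l).character_eq (xi_ne_zero l) (xi_ne_one l hl)
    (xi_sq_ne_one l hl) Fact.out (k_pow l) α
  have hs := character_s_eq_one l hl ht ht0 hα hk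
  have hk' (i : Fin 2) : α (mk l (Usigma.kInv l i)) = 1 := by
    have := congrArg α ((relations l).k_mul_kInv i)
    rwa [map_mul, hk, one_mul, map_one] at this
  intro x
  obtain ⟨x, rfl⟩ := mk_surjective l x
  rw [counit_mk]
  refine DFunLike.congr_fun (Usigma.algHom_ext (φ := α.comp (mk l))
    (ψ := Bialgebra.counitAlgHom ℂ (Usigma l)) ?_ ?_ ?_ ?_ ?_) x
  · intro i; simpa [Usigma.counit_k] using hk i
  · intro i; simpa [Usigma.counit_kInv] using hk' i
  · intro i; simpa [Usigma.counit_e] using he i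
  · intro i; simpa [Usigma.counit_f] using hf i
  · simpa [Usigma.counit_s] using hs

end SmallQuantumGroup

end SmallQuantumSl21

theorem mainTheorem7 (l : ℕ) [Fact (Odd l)] (hl : 3 ≤ l) :
    SmallQuantumSl21.IsUnimodular ℂ (SmallQuantumSl21.SmallQuantumGroup l) := by
  exact SmallQuantumSl21.SmallQuantumGroup.isUnimodular l hl
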